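/- **Setting.** A relational schema $\mathcal S=(\mathcal E,\mathcal R,\mathcal A,\mathrm{card})$ consists of entity classes $E\in\mathcal E$, relationship classes $R\in\mathcal R$, each with a finite set of participating entity classes, attribute classes $\mathcal A(I)$ for every item class $I\in\mathcal E\cup\mathcal R$, and cardinalities $\mathrm{card}(R,E)\in\{\mathrm{ONE},\mathrm{MANY}\}$. A relational path is a nonempty alternating sequence of entity classes and relationship classes, consecutive ones being linked by participation, with no segment $[E,R,E]$ and with a segment $[R,E,R]$ only if $\mathrm{card}(R,E)=\mathrm{MANY}$. A relational causal model structure $\mathcal M=(\mathcal S,\mathcal D)$ is a schema with a set $\mathcal D$ of dependencies $[I_j,\dots,I_k].Y\to[I_j].X$, where $[I_j,\dots,I_k]$ is a relational path, $Y\in\mathcal A(I_k)$ and $X\in\mathcal A(I_j)$. It is *acyclic* if its class dependency graph (vertices the attribute classes, an edge $Y\to X$ for each such dependency) has no directed cycle. A skeleton $\sigma\in\Sigma_{\mathcal S}$ assigns to every item class a set of instances and to every instance of a relationship class $R$ one participating instance of each entity class of $R$, such that, if $\mathrm{card}(R,E)=\mathrm{ONE}$, an instance of $E$ participates in at most one instance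 of $R$. The terminal set $P|_b$ of a path $P=[I_1,\dots,I_n]$ from an instance $b$ of $I_1$ is $P^n|_b$, where $P^1|_b=\{b\}$ and $P^{m+1}|_b$ is the set of instances of $I_{m+1}$ that are linked to an element of $P^m|_b$ and do not lie in $P^1|_b\cup\dots\cup P^m|_b$ (bridge burning semantics). The ground graph $GG_{\mathcal M\sigma}$ has as vertices the attributes $i.X$ of the instances $i$ in $\sigma$, and an edge $i_k.Y\to i_j.X$ whenever $[I_j,\dots,I_k].Y\to[I_j].X\in\mathcal D$ and $i_k\in[I_j,\dots,I_k]|_{i_j}$. The abstract ground graph $AGG_{\mathcal M\mathcal Bh}$ for a perspective $\mathcal B\in\mathcal E\cup\mathcal R$ and a hop threshold $h\in\{0,1,2,\dots\}\cup\{\infty\}$ has as vertices the relational variables $[\mathcal B,\dots,I].X$ with $X\in\mathcal A(I)$ and a path of at most $h+1$ item classes, and an intersection variable for every unordered pair of distinct relational variables $P_1.X$, $P_2.X$ such that $P_1|_b\cap P_2|_b\neq\emptyset$ for some instance $b$ of some skeleton. It has an edge $[\mathcal B,\dots,I_k].Y\to[\mathcal B,\dots,I_j].X$ whenever $[I_j,\dots,I_k].Y\to[I_j].X\in\mathcal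 D$ and $[\mathcal B,\dots,I_k]\in\mathrm{extend}([\mathcal B,\dots,I_j],[I_j,\dots,I_k])$. Here $\mathrm{extend}(P,Q)$ is the set of all relational paths of the form (the first $|P|-i+1$ classes of $P$) followed by ($Q$ without its first $i$ classes), where $i\ge1$ is such that $Q$ and the reversal of $P$ have the same initial segment of length $i$. An intersection variable inherits the edges between relational variables of both members of its pair: it has an edge to (from) a relational variable if one of its members has one. A graph is *ancestral* if it has no directed cycle, no almost directed cycle ($b\leftrightarrow a$ with $a$ an ancestor of $b$), and no endpoint of an undirected edge has a parent or a spouse. **Lemma.** Let $\mathcal M=(\mathcal S,\mathcal D)$ be a relational causal model structure. 1. If $\mathcal M$ is acyclic, then for every perspective $\mathcal B$ and every hop threshold $h\in\{0,1,2,\dots\}\cup\{\infty\}$, the abstract ground graph $AGG_{\mathcal M\mathcal Bh}$ is ancestral if and only if the ground graphs $GG_{\mathcal M\sigma}$ of all skeletons $\sigma\in\Sigma_{\mathcal S}$ are ancestral. 2. Without any acyclicity assumption, the abstract ground graphs $AGG_{\mathcal M\mathcal Bh}$ of all perspectives $\mathcal B$ and all hop thresholds $h\in\{0,1,2,\dots\}\cup\{\infty\}$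 are ancestral if and only if the ground graphs $GG_{\mathcal M\sigma}$ of all skeletons $\sigma\in\Sigma_{\mathcal S}$ are ancestral. -/

import Mathlib

universe u

/-! ### Relational schemas and relational paths -/

/-- The two possible values of a cardinality constraint. -/
inductive Cardinality where
  | one
  | many

/-- A relational schema: entity classes, relationship classes with their participating entity
classes, attribute classes (each owned by one item class, so that the attribute classes of an item
class `I` are those `X` with `owner X = I`), and the cardinality function. The value
`card R E = one` says that an instance of `E` takes part in at most one instance of `R`. -/
structure RelationalSchema where
  Ent : Type u
  Rel : Type u
  parts : Rel → Finset Ent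
  Attr : Type u
  owner : Attr → Ent ⊕ Rel
  card : Rel → Ent → Cardinality

namespace RelationalSchema

variable (S : RelationalSchema.{u})

/-- Item classes: entity classes (`Sum.inl`) and relationship classes (`Sum.inr`). -/
abbrev Item : Type u := S.Ent ⊕ S.Rel

/-- One of the two item classes is a relationship class, the other an entity class taking part
in it. -/
def Linked : S.Item → S.Item → Prop
  | Sum.inl E, Sum.inr R => E ∈ S.parts R
  | Sum.inr R, Sum.inl E => E ∈ S.parts R
  | _, _ => False

/-- Valid relational paths: nonempty alternating sequences of linked entity and relationship
classes without a segment `[E, R, E]`, and with a segment `[R, E, R]` only if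
`card R E = many`. -/
def IsPath (P : List S.Item) : Prop :=
  P ≠ [] ∧ P.IsChain S.Linked ∧
    (∀ E R, ¬ [Sum.inl E, Sum.inr R, Sum.inl E] <:+: P) ∧
    (∀ R E, [Sum.inr R, Sum.inl E, Sum.inr R] <:+: P → S.card R E = Cardinality.many)

/-- The positions `i` (counted from 1) at which `P` and `Q` have a common initial segment of
length `i`. -/
def pivots (P Q : List S.Item) : Set ℕ :=
  {i | 1 ≤ i ∧ i ≤ P.length ∧ i ≤ Q.length ∧ P.take i = Q.take i}

/-- The `extend` method: all valid concatenations of `P` and `Q` at a pivot of the reversal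
of `P` and `Q`. -/
def extend (P Q : List S.Item) : Set (List S.Item) :=
  {W | ∃ i ∈ S.pivots P.reverse Q,
    W = P.take (P.length - i + 1) ++ Q.drop i ∧ S.IsPath W}

end RelationalSchema

/-! ### Skeletons and terminal sets -/

/-- A relational skeleton: a set of instances for every item class, a participating entity
instance for every relationship instance and every entity class of its relationship class, subject
to the cardinality constraints. -/
structure Skeleton (S : RelationalSchema.{u}) where
  inst : S.Item → Type
  participant : ∀ (R : S.Rel) (_ : inst (Sum.inr R)) (E : S.Ent), E ∈ S.parts R → inst (Sum.inl E)
  card_one : ∀ (R : S.Rel) (E : S.Ent) (hE : E ∈ S.parts R), S.card R E = Cardinality.one →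
    Function.Injective fun r => participant R r E hE

namespace Skeleton

variable {S : RelationalSchema.{u}} (σ : Skeleton S)

/-- All item instances of a skeleton, each with its item class. -/
abbrev Instance : Type u := Σ I : S.Item, σ.inst I

/-- One of the instances is a relationship instance and the other takes part in it. -/
def Adj (x y : σ.Instance) : Prop :=
  ∃ (R : S.Rel) (r : σ.inst (Sum.inr R)) (E : S.Ent) (hE : E ∈ S.parts R),
    (x = ⟨Sum.inr R, r⟩ ∧ y = ⟨Sum.inl E, σ.participant R r E hE⟩) ∨
    (y = ⟨Sum.inr R, r⟩ ∧ x = ⟨Sum.inl E, σ.participant R r E hE⟩)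

/-- Follow the remaining item classes of a path from the instances in `front`; instances that
were reached before (those in `burnt`) are never reached again. -/
def traverse : List S.Item → Set σ.Instance → Set σ.Instance → Set σ.Instance
  | [], front, _ => front
  | I :: P, front, burnt =>
    let next : Set σ.Instance := {y | y.1 = I ∧ (∃ x ∈ front, σ.Adj x y) ∧ y ∉ burnt}
    traverse P next (burnt ∪ next)

/-- The terminal set of a relational path from the instance `b`, under the bridge burning
semantics. It is empty if `b` is not an instance of the first class of the path. -/
def terminalSet (b : σ.Instance) : List S.Item → Set σ.Instance
  | [] => ∅
  | I :: P => σ.traverse P {y | y = b ∧ b.1 = I} {b}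

end Skeleton

/-! ### Mixed graphs and ancestrality -/

/-- Graphs with directed, bidirected and undirected edges. -/
structure MixedGraph (V : Type*) where
  dir : V → V → Prop
  bi : V → V → Prop
  und : V → V → Prop
  bi_symm : ∀ a b, bi a b → bi b a
  und_symm : ∀ a b, und a b → und b a

namespace MixedGraph

variable {V : Type*}

/-- `a` is an ancestor of `b`: there is a (possibly trivial) directed path from `a` to `b`. -/
def IsAncestor (G : MixedGraph V) (a b : V) : Prop := Relation.ReflTransGen G.dir a b

/-- Ancestral graphs: no directed cycle, no almost directed cycle, and the endpoints of an
undirected edge have neither parents nor spouses. -/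
def IsAncestral (G : MixedGraph V) : Prop :=
  (∀ a b, G.dir b a → ¬ G.IsAncestor a b) ∧
  (∀ a b, G.bi b a → ¬ G.IsAncestor a b) ∧
  (∀ a b, G.und a b → ∀ c, ¬ G.dir c a ∧ ¬ G.bi c a ∧ ¬ G.dir c b ∧ ¬ G.bi c b)

/-- The mixed graph with the given directed edges and no others. -/
def ofDirected (r : V → V → Prop) : MixedGraph V where
  dir := r
  bi := fun _ _ => False
  und := fun _ _ => False
  bi_symm := fun _ _ h => h
  und_symm := fun _ _ h => h

end MixedGraph

/-! ### Relational causal model structures -/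

/-- A canonical relational dependency `[I_X, ..., I_Y].Y → [I_X].X`, where `causePath` is the path
`[I_X, ..., I_Y]`, `cause` is `Y` and `effect` is `X`. -/
structure Dependency (S : RelationalSchema.{u}) where
  causePath : List S.Item
  cause : S.Attr
  effect : S.Attr
  isPath : S.IsPath causePath
  head_eq : causePath.head? = some (S.owner effect)
  last_eq : causePath.getLast? = some (S.owner cause)

/-- The structure of a relational causal model: a set of relational dependencies. -/
structure RelationalModel (S : RelationalSchema.{u}) where
  deps : Set (Dependency S)

/-- Relational variables `[B, ..., I].X` of perspective `B` and with at most `h` hops; `h = ⊤` is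
no bound. -/
structure RelVar (S : RelationalSchema.{u}) (B : S.Item) (h : ℕ∞) where
  path : List S.Item
  attr : S.Attr
  isPath : S.IsPath path
  head_eq : path.head? = some B
  last_eq : path.getLast? = some (S.owner attr)
  length_le : (path.length : ℕ∞) ≤ h + 1

/-- Two distinct relational variables with the same attribute class can intersect: in some
skeleton, the terminal sets of their paths from some instance have a common element. -/
def RelVar.CanIntersect {S : RelationalSchema.{u}} {B : S.Item} {h : ℕ∞}
    (U V : RelVar S B h) : Prop :=
  U ≠ V ∧ U.attr = V.attr ∧
    ∃ (σ : Skeleton S) (b : σ.Instance),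
      (σ.terminalSet b U.path ∩ σ.terminalSet b V.path).Nonempty

/-- Vertices of an abstract ground graph: relational variables, and intersection variables, i.e.
unordered pairs of relational variables that can intersect. -/
inductive AGGVertex (S : RelationalSchema.{u}) (B : S.Item) (h : ℕ∞) where
  | var (U : RelVar S B h)
  | inter (p : Sym2 (RelVar S B h)) (hp : ∃ U V, U.CanIntersect V ∧ p = s(U, V))

namespace RelationalModel

variable {S : RelationalSchema.{u}} (M : RelationalModel S)

/-- Edges of the class dependency graph, whose vertices are the attribute classes. -/
def ClassDep (Y X : S.Attr) : Prop := ∃ d ∈ M.deps, d.cause = Y ∧ d.effect = X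

/-- The model is acyclic: its class dependency graph has no directed cycle. -/
def IsAcyclic : Prop := ∀ X, ¬ Relation.TransGen M.ClassDep X X

/-- Vertices of the ground graph: an attribute of an item instance. -/
abbrev GGVertex (σ : Skeleton S) : Type u :=
  {v : σ.Instance × S.Attr // S.owner v.2 = v.1.1}

/-- The ground graph of the model over a skeleton. -/
def groundGraph (σ : Skeleton S) : MixedGraph (GGVertex σ) :=
  MixedGraph.ofDirected fun y x =>
    ∃ d ∈ M.deps, d.cause = y.1.2 ∧ d.effect = x.1.2 ∧
      y.1.1 ∈ σ.terminalSet x.1.1 d.causePath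

/-- Edges `[B, ..., I_k].Y → [B, ..., I_j].X` between relational variables. -/
def VarEdge {B : S.Item} {h : ℕ∞} (V U : RelVar S B h) : Prop :=
  ∃ d ∈ M.deps, d.cause = V.attr ∧ d.effect = U.attr ∧ V.path ∈ S.extend U.path d.causePath

/-- Edges of the abstract ground graph. Intersection variables inherit the edges of both
relational variables of the pair. -/
def AGGEdge {B : S.Item} {h : ℕ∞} : AGGVertex S B h → AGGVertex S B h → Prop
  | .var V, .var U => M.VarEdge V U
  | .inter p _, .var U => ∃ V ∈ p, M.VarEdge V U
  | .var V, .inter q _ => ∃ U ∈ q, M.VarEdge V U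
  | .inter _ _, .inter _ _ => False

/-- The abstract ground graph of the model for perspective `B` and hop threshold `h`. -/
def abstractGroundGraph (B : S.Item) (h : ℕ∞) : MixedGraph (AGGVertex S B h) :=
  MixedGraph.ofDirected M.AGGEdge

end RelationalModel

/-! ### Lists with constraints on consecutive pairs and triples -/

section Trail

variable {α β : Type*}

/-- Consecutive elements of the list satisfy `r`, consecutive triples satisfy `t`. -/
def IsTrail (r : α → α → Prop) (t : α → α → α → Prop) : List α → Prop
  | a :: b :: c :: l => r a b ∧ t a b c ∧ IsTrail r t (b :: c :: l)
  | [a, b] => r a b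
  | _ => True

variable {r : α → α → Prop} {t : α → α → α → Prop}

theorem isTrail_cons_cons {a b : α} {l : List α} :
    IsTrail r t (a :: b :: l) ↔
      r a b ∧ IsTrail r t (b :: l) ∧ ∀ c ∈ l.head?, t a b c := by
  cases l with
  | nil => simp [IsTrail]
  | cons c l => simp [IsTrail]; tauto

theorem isTrail_singleton (a : α) : IsTrail r t [a] := trivial

/-- Triples see only one neighbour on each side of `z`, so gluing at a shared element adds a single
condition. -/
theorem isTrail_junction {A D : List α} {z : α} :
    IsTrail r t (A ++ z :: D) ↔
      IsTrail r t (A ++ [z]) ∧ IsTrail r t (z :: D) ∧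
        ∀ a ∈ A.getLast?, ∀ d ∈ D.head?, t a z d := by
  induction A with
  | nil => simp [IsTrail]
  | cons a A ih =>
    cases A with
    | nil => simp [isTrail_cons_cons, IsTrail]
    | cons b A =>
      simp only [List.cons_append, isTrail_cons_cons, List.getLast?_cons_cons] at ih ⊢
      rw [ih]
      have : (A ++ z :: D).head? = (A ++ [z]).head? := by cases A <;> simp
      rw [this]
      tauto

theorem IsTrail.left {A D : List α} {z : α} (h : IsTrail r t (A ++ z :: D)) :
    IsTrail r t (A ++ [z]) := (isTrail_junction.1 h).1

theorem IsTrail.right {A D : List α} {z : α} (h : IsTrail r t (A ++ z :: D)) :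
    IsTrail r t (z :: D) := (isTrail_junction.1 h).2.1

theorem IsTrail.tail {a : α} {l : List α} (h : IsTrail r t (a :: l)) : IsTrail r t l := by
  cases l with
  | nil => trivial
  | cons b l => exact (isTrail_cons_cons.1 h).2.1

theorem IsTrail.suffix {A D : List α} (h : IsTrail r t (A ++ D)) : IsTrail r t D := by
  induction A with
  | nil => exact h
  | cons a A ih => exact ih (IsTrail.tail h)

theorem IsTrail.prefix {A D : List α} (h : IsTrail r t (A ++ D)) : IsTrail r t A := by
  rcases List.eq_nil_or_concat A with rfl | ⟨A, z, rfl⟩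
  · trivial
  · simp only [List.concat_eq_append, List.append_assoc, List.singleton_append] at h ⊢
    exact h.left

theorem IsTrail.reverse (hr : ∀ a b, r a b → r b a) (ht : ∀ a b c, t a b c → t c b a)
    {l : List α} (h : IsTrail r t l) : IsTrail r t l.reverse := by
  induction l with
  | nil => trivial
  | cons a l ih =>
    cases l with
    | nil => trivial
    | cons b l =>
      obtain ⟨hab, hl, hc⟩ := isTrail_cons_cons.1 h
      have := ih hl
      simp only [List.reverse_cons, List.append_assoc, List.singleton_append] at this ⊢
      rw [isTrail_junction]
      refine ⟨this, hr _ _ hab, ?_⟩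
      intro x hx d hd
      simp only [List.getLast?_reverse] at hx
      simp only [List.head?_cons, Option.mem_def, Option.some.injEq] at hd
      subst hd
      exact ht _ _ _ (hc x hx)

theorem isTrail_map {f : β → α} {l : List β} :
    IsTrail r t (l.map f) ↔
      IsTrail (fun a b => r (f a) (f b)) (fun a b c => t (f a) (f b) (f c)) l := by
  induction l with
  | nil => simp [IsTrail]
  | cons a l ih =>
    cases l with
    | nil => simp [IsTrail]
    | cons b l =>
      simp only [List.map_cons] at ih ⊢
      rw [isTrail_cons_cons, isTrail_cons_cons, ih]
      cases l <;> simp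

theorem IsTrail.mono {r' : α → α → Prop} {t' : α → α → α → Prop}
    (hr : ∀ a b, r a b → r' a b) (ht : ∀ a b c, r a b → r b c → t a b c → t' a b c)
    {l : List α} (h : IsTrail r t l) : IsTrail r' t' l := by
  induction l with
  | nil => trivial
  | cons a l ih =>
    cases l with
    | nil => trivial
    | cons b l =>
      rw [isTrail_cons_cons] at h ⊢
      refine ⟨hr _ _ h.1, ih h.2.1, fun c hc => ht _ _ _ h.1 ?_ (h.2.2 c hc)⟩
      cases l with
      | nil => simp at hc
      | cons d l =>
        simp at hc; subst hc
        exact (isTrail_cons_cons.1 h.2.1).1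

theorem IsTrail.getElem {l : List α} (h : IsTrail r t l) (i : ℕ) (hi : i + 1 < l.length) :
    r l[i] l[i + 1] ∧ ∀ h2 : i + 2 < l.length, t l[i] l[i + 1] l[i + 2] := by
  induction l generalizing i with
  | nil => simp at hi
  | cons a l ih =>
    cases l with
    | nil => simp at hi
    | cons b l =>
      obtain ⟨h1, h2, h3⟩ := isTrail_cons_cons.1 h
      cases i with
      | zero =>
        refine ⟨h1, fun h4 => ?_⟩
        cases l with
        | nil => simp at h4
        | cons c l => exact h3 c rfl
      | succ i =>
        have := ih h2 i (by simpa using hi)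
        exact ⟨this.1, fun h4 => this.2 (by simpa using h4)⟩

theorem IsTrail.of_infix {A B C : List α} (h : IsTrail r t (A ++ B ++ C)) : IsTrail r t B :=
  h.prefix.suffix

/-- Maximal common prefix of two lists. -/
theorem exists_common_prefix (u v : List α) :
    ∃ C u' v', u = C ++ u' ∧ v = C ++ v' ∧ ∀ a ∈ u'.head?, ∀ b ∈ v'.head?, a ≠ b := by
  classical
  induction u generalizing v with
  | nil => exact ⟨[], [], v, by simp⟩
  | cons a u ih =>
    cases v with
    | nil => exact ⟨[], a :: u, [], by simp⟩
    | cons b v =>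
      by_cases hab : a = b
      · subst hab
        obtain ⟨C, u', v', rfl, rfl, h⟩ := ih v
        exact ⟨a :: C, u', v', by simp, by simp, h⟩
      · exact ⟨[], a :: u, b :: v, by simp, by simp, by simpa using hab⟩

/-- Reduced concatenation of a trail ending in `y` and a trail starting in `y`. -/
theorem exists_reduced_concat (ht : ∀ a b c, a ≠ c → t a b c)
    {p q : List α} {y : α} (hp : IsTrail r t p) (hq : IsTrail r t q)
    (hpy : p.getLast? = some y) (hqy : q.head? = some y) :
    ∃ A z C D, p = A ++ z :: C.reverse ∧ q = C ++ z :: D ∧ IsTrail r t (A ++ z :: D) := by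
  obtain ⟨C, u, v, hu, rfl, hne⟩ := exists_common_prefix p.reverse q
  have hC : C ≠ [] := by
    rintro rfl
    simp only [List.nil_append] at hu hqy
    refine hne y ?_ y hqy rfl
    rw [← hu, List.head?_reverse]
    exact hpy
  obtain ⟨C, z, rfl⟩ := (List.eq_nil_or_concat C).resolve_left hC
  have hp' : p = u.reverse ++ z :: C.reverse := by
    rw [← List.reverse_reverse p, hu]; simp
  subst hp'
  refine ⟨u.reverse, z, C, v, rfl, by simp, ?_⟩
  rw [isTrail_junction]
  refine ⟨hp.left, ?_, ?_⟩
  · simp only [List.concat_eq_append, List.append_assoc, List.singleton_append] at hq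
    exact hq.right
  · intro a ha d hd
    rw [List.getLast?_reverse] at ha
    exact ht _ _ _ (hne a ha d hd)

/-- A list is a palindrome or has a longest matching pair of ends. -/
theorem reverse_eq_or_exists_ends (P : List α) :
    P.reverse = P ∨ ∃ T a l b, a ≠ b ∧ P = T ++ a :: (l ++ b :: T.reverse) := by
  classical
  induction P using List.bidirectionalRec with
  | nil => simp
  | singleton a => simp
  | cons_append a l b ih =>
    by_cases hab : a = b
    · subst hab
      rcases ih with h | ⟨T, c, l', d, hcd, rfl⟩
      · left; simp [h]
      · right; exact ⟨a :: T, c, l', d, hcd, by simp⟩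
    · right; exact ⟨[], a, l, b, hab, by simp⟩

/-- Distinct lists of the same length with the same first and the same last element, split into
their maximal common prefix and suffix and the parts between these. -/
theorem exists_fork {A A' : List α} (hne : A ≠ A') (hlen : A.length = A'.length)
    (hhead : A.head? = A'.head?) (hlast : A.getLast? = A'.getLast?) :
    ∃ Z z X X' d D, A = Z ++ z :: (X ++ d :: D) ∧ A' = Z ++ z :: (X' ++ d :: D) ∧
      X.length = X'.length ∧ X ≠ [] ∧ X' ≠ [] ∧ (∀ a ∈ X.head?, ∀ b ∈ X'.head?, a ≠ b) ∧
      (∀ a ∈ X.getLast?, ∀ b ∈ X'.getLast?, a ≠ b) := by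
  obtain ⟨C, u, u', rfl, rfl, hu⟩ := exists_common_prefix A A'
  have hul : u.length = u'.length := by simpa using hlen
  have hune : u ≠ [] := by
    rintro rfl
    have : u' = [] := List.length_eq_zero_iff.1 (by simpa using hul.symm)
    subst this
    exact hne rfl
  have hune' : u' ≠ [] := by
    rintro rfl
    exact hune (List.length_eq_zero_iff.1 (by simpa using hul))
  have hC : C ≠ [] := by
    rintro rfl
    obtain ⟨a, l, rfl⟩ := List.exists_cons_of_ne_nil hune
    simp only [List.nil_append, List.head?_cons] at hhead
    exact hu a rfl a hhead.symm rfl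
  obtain ⟨Z, z, rfl⟩ := (List.eq_nil_or_concat C).resolve_left hC
  obtain ⟨E, v, v', hv, hv', hvv⟩ := exists_common_prefix u.reverse u'.reverse
  have hu1 : u = v.reverse ++ E.reverse := by rw [← List.reverse_reverse u, hv]; simp
  have hu2 : u' = v'.reverse ++ E.reverse := by rw [← List.reverse_reverse u', hv']; simp
  subst hu1 hu2
  have hvl : v.length = v'.length := by simpa using hul
  have hvne : v ≠ [] := by
    rintro rfl
    have : v' = [] := List.length_eq_zero_iff.1 (by simpa using hvl.symm)
    subst this
    exact hne rfl
  have hvne' : v' ≠ [] := by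
    rintro rfl
    exact hvne (List.length_eq_zero_iff.1 (by simpa using hvl))
  have hE : E ≠ [] := by
    rintro rfl
    obtain ⟨a, l, rfl⟩ := List.exists_cons_of_ne_nil hvne
    obtain ⟨a', l', rfl⟩ := List.exists_cons_of_ne_nil hvne'
    have : a = a' := by
      simpa [List.getLast?_append, List.getLast?_cons] using hlast
    exact hvv a rfl a' rfl this
  obtain ⟨E, d, rfl⟩ := (List.eq_nil_or_concat E).resolve_left hE
  all_goals try simp only [List.concat_eq_append] at *
  refine ⟨Z, z, v.reverse, v'.reverse, d, E.reverse, by simp, by simp, by simpa using hvl,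
    by simp [hvne], by simp [hvne'], ?_, ?_⟩
  · intro a ha b hb
    apply hu a _ b
    · simp only [Option.mem_def] at hb ⊢
      rw [List.head?_append, hb]; rfl
    · simp only [Option.mem_def] at ha ⊢
      rw [List.head?_append, ha]; rfl
  · intro a ha b hb
    rw [List.getLast?_reverse] at ha hb
    exact hvv a ha b hb

end Trail

/-! ### Relational paths as trails -/

namespace RelationalSchema

variable {S : RelationalSchema.{u}}

/-- An instance of the entity class `I` may take part in several instances of the relationship
class `J`. -/
def Branching (S : RelationalSchema.{u}) (I J : S.Item) : Prop :=
  ∃ E R, I = Sum.inl E ∧ J = Sum.inr R ∧ S.card R E = Cardinality.many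

/-- The segment `[I, J, K]` is allowed in a relational path. -/
def Turn (S : RelationalSchema.{u}) (I J K : S.Item) : Prop := I = K → S.Branching J K

theorem Linked.symm {I J : S.Item} (h : S.Linked I J) : S.Linked J I := by
  cases I <;> cases J <;> exact h

theorem Turn.symm {I J K : S.Item} (h : S.Turn I J K) : S.Turn K J I := by
  rintro rfl; exact h rfl

theorem turn_of_ne {I J K : S.Item} (h : I ≠ K) : S.Turn I J K := fun h' => absurd h' h

theorem Linked.isLeft {I J : S.Item} (h : S.Linked I J) : I.isLeft = !J.isLeft := by
  cases I <;> cases J <;> simp_all [Linked]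

theorem itemTrail_reverse {P : List S.Item} (h : IsTrail S.Linked S.Turn P) : IsTrail S.Linked S.Turn P.reverse :=
  IsTrail.reverse (fun _ _ h => h.symm) (fun _ _ _ h => h.symm) h

/-- Both rules on segments become one: `Branching` fails when its first argument is a relationship
class, so `Turn` excludes `[E, R, E]` outright. In this form the conditions are symmetric under
reversal. -/
theorem isPath_iff {P : List S.Item} : S.IsPath P ↔ P ≠ [] ∧ IsTrail S.Linked S.Turn P := by
  constructor
  · rintro ⟨h0, h1, h2, h3⟩
    refine ⟨h0, ?_⟩
    clear h0
    induction P with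
    | nil => trivial
    | cons a P ih =>
      cases P with
      | nil => trivial
      | cons b P =>
        rw [isTrail_cons_cons]
        rw [List.isChain_cons_cons] at h1
        refine ⟨h1.1, ih h1.2 (fun E R h => h2 E R (h.trans (List.suffix_cons _ _).isInfix))
          (fun E R h => h3 E R (h.trans (List.suffix_cons _ _).isInfix)), ?_⟩
        intro c hc
        cases P with
        | nil => simp at hc
        | cons d P =>
          simp only [List.head?_cons, Option.mem_def, Option.some.injEq] at hc
          subst hc
          rintro rfl
          have hinf : [a, b, a] <:+: a :: b :: a :: P := ⟨[], P, by simp⟩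
          cases a with
          | inl E =>
            cases b with
            | inl _ => exact h1.1.elim
            | inr R => exact absurd hinf (h2 E R)
          | inr R =>
            cases b with
            | inl E => exact ⟨E, R, rfl, rfl, h3 R E hinf⟩
            | inr _ => exact h1.1.elim
  · rintro ⟨h0, h1⟩
    have key : ∀ a b c, [a, b, c] <:+: P → S.Turn a b c := by
      rintro a b c ⟨s, t, rfl⟩
      have := IsTrail.of_infix h1
      exact this.2.1
    refine ⟨h0, ?_, ?_, ?_⟩
    · clear h0 key
      induction P with
      | nil => simp
      | cons a P ih =>
        cases P with
        | nil => simp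
        | cons b P =>
          rw [isTrail_cons_cons] at h1
          rw [List.isChain_cons_cons]
          exact ⟨h1.1, ih h1.2.1⟩
    · intro E R h
      obtain ⟨E', R', h', h'', -⟩ := key _ _ _ h rfl
      cases h'
    · intro R E h
      obtain ⟨E', R', h', h'', hm⟩ := key _ _ _ h rfl
      simp at h' h''
      subst h' h''
      exact hm

theorem isLeft_eq_iff_even {I J : S.Item} {P : List S.Item} (h : IsTrail S.Linked S.Turn (I :: P))
    (hJ : (I :: P).getLast? = some J) : I.isLeft = J.isLeft ↔ Even P.length := by
  induction P generalizing I with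
  | nil => simp at hJ; simp [hJ]
  | cons K P ih =>
    obtain ⟨h1, h2, -⟩ := isTrail_cons_cons.1 h
    have := ih h2 (by simpa using hJ)
    rw [List.length_cons, Nat.even_add_one, ← this, h1.isLeft]
    cases K.isLeft <;> cases J.isLeft <;> simp

/-- Here `C` followed by `z` is the shared segment, with `z` at the pivot; `C` is the part that
cancels. -/
theorem mem_extend_of {A C D : List S.Item} {z : S.Item} (h : IsTrail S.Linked S.Turn (A ++ z :: D)) :
    A ++ z :: D ∈ S.extend (A ++ z :: C.reverse) (C ++ z :: D) := by
  refine ⟨C.length + 1, ⟨by omega, by simp, by simp, ?_⟩, ?_, isPath_iff.2 ⟨by simp, h⟩⟩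
  · simp [List.take_append, List.take_of_length_le]
  · have : (A ++ z :: C.reverse).length - (C.length + 1) + 1 = A.length + 1 := by
      simp
    rw [this]
    simp [List.take_append, List.drop_append, List.take_of_length_le]

theorem exists_of_mem_extend {P Q W : List S.Item} (h : W ∈ S.extend P Q) :
    ∃ A z C D, P = A ++ z :: C.reverse ∧ Q = C ++ z :: D ∧ W = A ++ z :: D ∧
      IsTrail S.Linked S.Turn W := by
  obtain ⟨i, ⟨hi1, hi2, hi3, he⟩, hW, hp⟩ := h
  have hne : Q.take i ≠ [] := by
    intro h0
    have := congrArg List.length h0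
    rw [List.length_take, List.length_nil] at this
    omega
  obtain ⟨C, z, hC⟩ := (List.eq_nil_or_concat _).resolve_left hne
  rw [List.concat_eq_append] at hC
  have hCl : C.length + 1 = i := by
    have := congrArg List.length hC
    rw [List.length_take, List.length_append, List.length_singleton] at this
    omega
  have hQ : Q = C ++ z :: Q.drop i := by
    conv_lhs => rw [← List.take_append_drop i Q, hC]
    simp
  have hP : P = (P.reverse.drop i).reverse ++ z :: C.reverse := by
    have : P.reverse = C ++ [z] ++ P.reverse.drop i := by
      rw [← hC, ← he, List.take_append_drop]
    conv_lhs => rw [← List.reverse_reverse P, this]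
    simp
  refine ⟨(P.reverse.drop i).reverse, z, C, Q.drop i, hP, hQ, ?_, (isPath_iff.1 hp).2⟩
  rw [hW]
  generalize (P.reverse.drop i).reverse = A at hP
  subst hP
  have : (A ++ z :: C.reverse).length - i + 1 = A.length + 1 := by
    simp; omega
  rw [this]
  simp [List.take_append]

end RelationalSchema

/-! ### Partial skeletons -/

/-- A graph of instances satisfying the cardinality constraints of a schema, in which relationship
instances may lack participants. -/
structure PartialSkeleton (S : RelationalSchema.{u}) where
  Node : Type
  cls : Node → S.Item
  adj : Node → Node → Prop
  symm : ∀ {x y}, adj x y → adj y x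
  linked : ∀ {x y}, adj x y → S.Linked (cls x) (cls y)
  turn : ∀ {x y z}, adj y x → adj y z → x ≠ z → S.Turn (cls x) (cls y) (cls z)

namespace PartialSkeleton

open RelationalSchema

variable {S : RelationalSchema.{u}} (G : PartialSkeleton S)

/-- Walks that never turn back. -/
abbrev IsWalk (p : List G.Node) : Prop := IsTrail G.adj (fun a _ c => a ≠ c) p

/-- `p` is a walk from `x` to `y` that never turns back. -/
structure Walk (x y : G.Node) (p : List G.Node) : Prop where
  isWalk : IsTrail G.adj (fun a _ c => a ≠ c) p
  head : p.head? = some x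
  last : p.getLast? = some y

variable {G}

theorem isWalk_reverse {p : List G.Node} (h : G.IsWalk p) : G.IsWalk p.reverse :=
  IsTrail.reverse (fun _ _ h => G.symm h) (fun _ _ _ h => h.symm) h

theorem Walk.reverse {x y : G.Node} {p : List G.Node} (h : G.Walk x y p) :
    G.Walk y x p.reverse :=
  ⟨isWalk_reverse h.isWalk, by simpa using h.last, by simpa using h.head⟩

theorem Walk.single (x : G.Node) : G.Walk x x [x] := ⟨trivial, rfl, rfl⟩

theorem IsWalk.map_cls {p : List G.Node} (h : G.IsWalk p) :
    IsTrail S.Linked S.Turn (p.map G.cls) := by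
  rw [isTrail_map]
  refine IsTrail.mono (r := G.adj) (t := fun a _ c => a ≠ c) ?_ ?_ h
  · exact fun _ _ h => G.linked h
  · exact fun _ _ _ h1 h2 h3 => G.turn (G.symm h1) h2 h3

theorem Walk.isPath {x y : G.Node} {p : List G.Node} (h : G.Walk x y p) :
    S.IsPath (p.map G.cls) := by
  refine isPath_iff.2 ⟨?_, IsWalk.map_cls h.isWalk⟩
  have := h.head
  rintro h0
  rw [List.map_eq_nil_iff] at h0
  simp [h0] at this

/-- Composing walks along relational paths `P` and `Q` yields a walk along a path that extends
`P` by `Q`. -/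
theorem Walk.exists_extend {x y z : G.Node} {p q : List G.Node} (hp : G.Walk x y p)
    (hq : G.Walk y z q) :
    ∃ w, G.Walk x z w ∧ w.map G.cls ∈ S.extend (p.map G.cls) (q.map G.cls) := by
  obtain ⟨A, a, C, D, rfl, rfl, h⟩ :=
    exists_reduced_concat (fun _ _ _ h => h) hp.isWalk hq.isWalk hp.last hq.head
  refine ⟨A ++ a :: D, ⟨h, ?_, ?_⟩, ?_⟩
  · have := hp.head
    rw [List.head?_append] at this ⊢
    simpa using this
  · have := hq.last
    rw [List.getLast?_append] at this ⊢
    simpa [List.getLast?_cons] using this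
  · have := IsWalk.map_cls h
    simp only [List.map_append, List.map_cons, List.map_reverse] at this ⊢
    exact mem_extend_of this

/-! ### Full partial skeletons: prescribed walks and splitting -/

variable (G)

/-- The item classes of all nodes lie in `J`, and every node can be left towards any linked class
of `J`, avoiding finitely many nodes as far as the cardinalities admit this. -/
structure IsFull (J : Set S.Item) : Prop where
  cls_mem : ∀ x, G.cls x ∈ J
  exists_adj : ∀ x, ∀ I ∈ J, S.Linked (G.cls x) I → ∀ F : Set G.Node, F.Finite →
    (∀ f ∈ F, S.Turn (G.cls f) (G.cls x) I) → ∃ y, G.adj x y ∧ G.cls y = I ∧ y ∉ F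

variable {G} {J : Set S.Item}

theorem IsFull.exists_walk (hG : G.IsFull J) (Q : List S.Item) :
    ∀ (x : G.Node) (F : Set G.Node), F.Finite → (∀ I ∈ Q, I ∈ J) →
    IsTrail S.Linked S.Turn (G.cls x :: Q) →
    (∀ f ∈ F, ∀ I ∈ Q.head?, S.Turn (G.cls f) (G.cls x) I) →
    ∃ k : List G.Node, k.map G.cls = Q ∧ G.IsWalk (x :: k) ∧ ∀ y ∈ k.head?, y ∉ F := by
  induction Q with
  | nil => exact fun x F _ _ _ _ => ⟨[], rfl, trivial, by simp⟩
  | cons I Q ih =>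
    intro x F hF hQ hp hturn
    obtain ⟨h1, h2, h3⟩ := isTrail_cons_cons.1 hp
    obtain ⟨y, hxy, rfl, hyF⟩ := hG.exists_adj x I (hQ I (by simp)) h1 F hF
      (fun f hf => hturn f hf I rfl)
    obtain ⟨k, rfl, hk, hk'⟩ := ih y {x} (Set.finite_singleton x)
      (fun K hK => hQ K (by simp [hK])) h2 (by rintro f rfl K hK; exact h3 K hK)
    refine ⟨y :: k, rfl, isTrail_cons_cons.2 ⟨hxy, hk, ?_⟩, by simpa using hyF⟩
    intro c hc h
    exact hk' c hc h.symm

/-- In a full partial skeleton, a walk along an extension of `P` by `Q` comes from a walk along `P`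
followed by a walk along `Q`. -/
theorem IsFull.exists_split (hG : G.IsFull J) {P Q : List S.Item} (hPt : IsTrail S.Linked S.Turn P)
    (hQt : IsTrail S.Linked S.Turn Q) (hQ : ∀ I ∈ Q, I ∈ J)
    {x y : G.Node} {w : List G.Node} (hw : G.Walk x y w)
    (hex : w.map G.cls ∈ S.extend P Q) :
    ∃ z p q, G.Walk x z p ∧ p.map G.cls = P ∧ G.Walk z y q ∧ q.map G.cls = Q := by
  obtain ⟨A, a, C, D, rfl, rfl, hW, -⟩ := exists_of_mem_extend hex
  obtain ⟨α, w', rfl, rfl, hw'⟩ := List.map_eq_append_iff.1 hW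
  obtain ⟨ζ, δ, rfl, rfl, rfl⟩ := List.map_eq_cons_iff.1 hw'
  have hQr := itemTrail_reverse hQt
  simp only [List.reverse_append, List.reverse_cons, List.append_assoc,
    List.singleton_append] at hQr
  -- Restore the cancelled part by a detour `k` from the pivot node `ζ`. It avoids both neighbours
  -- of `ζ` on the walk, so neither half turns back at `ζ`. The cardinalities permit this because
  -- `P` and `Q` are valid paths.
  obtain ⟨k, hk, hkw, hkF⟩ := hG.exists_walk C.reverse ζ
    {f | f ∈ α.getLast? ∨ f ∈ δ.head?}
    (by
      apply Set.Finite.union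
      · exact Set.Subsingleton.finite fun a ha b hb => Option.mem_unique ha hb
      · exact Set.Subsingleton.finite fun a ha b hb => Option.mem_unique ha hb)
    (fun I hI => hQ I (by simp at hI; simp [hI])) hPt.right
    (by
      rintro f (hf | hf) I hI
      · refine (isTrail_junction.1 hPt).2.2 _ ?_ I hI
        simp only [List.getLast?_map, Option.mem_def] at hf ⊢
        rw [hf]; rfl
      · refine (isTrail_junction.1 hQr).2.2 _ ?_ I hI
        simp only [List.getLast?_reverse, List.head?_map, Option.mem_def] at hf ⊢
        rw [hf]; rfl)
  have hp : G.IsWalk (α ++ ζ :: k) := by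
    refine isTrail_junction.2 ⟨hw.isWalk.left, hkw, ?_⟩
    rintro f hf d hd rfl
    exact hkF _ hd (Or.inl hf)
  have hq : G.IsWalk (k.reverse ++ ζ :: δ) := by
    refine isTrail_junction.2 ⟨?_, hw.isWalk.right, ?_⟩
    · simpa using isWalk_reverse hkw
    · rintro f hf d hd rfl
      rw [List.getLast?_reverse] at hf
      exact hkF _ hf (Or.inr hd)
  obtain ⟨z, hz⟩ : ∃ z, (ζ :: k).getLast? = some z := ⟨_, List.getLast?_eq_getLast_of_ne_nil (by simp)⟩
  refine ⟨z, α ++ ζ :: k, k.reverse ++ ζ :: δ, ⟨hp, ?_, ?_⟩, by simp [hk], ⟨hq, ?_, ?_⟩, ?_⟩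
  · have := hw.head
    rw [List.head?_append] at this ⊢
    simpa using this
  · rw [List.getLast?_append, hz]; rfl
  · rw [← hz, ← List.head?_reverse]
    simp
  · have := hw.last
    rw [List.getLast?_append] at this ⊢
    simpa [List.getLast?_cons] using this
  · rw [List.map_append, List.map_reverse, hk]; simp

/-! ### The skeleton of a full partial skeleton -/

theorem IsFull.exists_participant (hG : G.IsFull J)
    (hJ : ∀ R, Sum.inr R ∈ J → ∀ E ∈ S.parts R, Sum.inl E ∈ J) {x : G.Node} {R : S.Rel}
    (hx : G.cls x = Sum.inr R) {E : S.Ent} (hE : E ∈ S.parts R) :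
    ∃ y, G.adj x y ∧ G.cls y = Sum.inl E := by
  obtain ⟨y, h1, h2, -⟩ := hG.exists_adj x (Sum.inl E) (hJ R (hx ▸ hG.cls_mem x) E hE)
    (by rw [hx]; exact hE) ∅ Set.finite_empty (by simp)
  exact ⟨y, h1, h2⟩

/-- The skeleton whose instances of `I` are the nodes of class `I`. -/
noncomputable def toSkeleton (hG : G.IsFull J)
    (hJ : ∀ R, Sum.inr R ∈ J → ∀ E ∈ S.parts R, Sum.inl E ∈ J) : Skeleton S where
  inst I := {x : G.Node // G.cls x = I}
  participant R r E hE := ⟨(hG.exists_participant hJ r.2 hE).choose,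
    (hG.exists_participant hJ r.2 hE).choose_spec.2⟩
  card_one R E hE hc r r' h := by
    by_contra hne
    have h1 := (hG.exists_participant hJ r.2 hE).choose_spec
    have h2 := (hG.exists_participant hJ r'.2 hE).choose_spec
    rw [Subtype.mk.injEq] at h
    rw [← h] at h2
    have := G.turn (G.symm h1.1) (G.symm h2.1) (fun h => hne (Subtype.ext h))
    obtain ⟨E', R', hE', hR', hm⟩ := this (r.2.trans r'.2.symm)
    rw [h1.2] at hE'
    rw [r'.2] at hR'
    cases hE'
    cases hR'
    rw [hc] at hm
    cases hm

variable (hG : G.IsFull J) (hJ : ∀ R, Sum.inr R ∈ J → ∀ E ∈ S.parts R, Sum.inl E ∈ J)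

/-- A node as an instance of the skeleton. -/
def toInstance (x : G.Node) : (toSkeleton hG hJ).Instance := ⟨G.cls x, x, rfl⟩

theorem toInstance_val {I : S.Item} (c : {x : G.Node // G.cls x = I}) :
    toInstance hG hJ c.1 = ⟨I, c⟩ := by
  obtain ⟨c, rfl⟩ := c
  rfl

theorem toInstance_surjective : Function.Surjective (toInstance hG hJ) := by
  rintro ⟨I, x, rfl⟩
  exact ⟨x, rfl⟩

theorem toInstance_injective : Function.Injective (toInstance hG hJ) := by
  intro x y h
  have : ∀ a b : (toSkeleton hG hJ).Instance, a = b → a.2.1 = b.2.1 := by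
    rintro a b rfl; rfl
  exact this _ _ h

theorem adj_participant (R : S.Rel) (r : {x : G.Node // G.cls x = Sum.inr R}) (E : S.Ent)
    (hE : E ∈ S.parts R) :
    G.adj r.1 ((toSkeleton hG hJ).participant R r E hE).1 :=
  (hG.exists_participant hJ r.2 hE).choose_spec.1

/-- The skeleton is built from chosen participants, but no information is lost: by `turn`, a
relationship node has at most one neighbour of each entity class. -/
theorem adj_toInstance {x y : G.Node} :
    (toSkeleton hG hJ).Adj (toInstance hG hJ x) (toInstance hG hJ y) ↔ G.adj x y := by
  have key : ∀ (R : S.Rel) (r : {x : G.Node // G.cls x = Sum.inr R}) (E : S.Ent)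
      (hE : E ∈ S.parts R) (a b : G.Node), toInstance hG hJ a = ⟨Sum.inr R, r⟩ →
      toInstance hG hJ b = ⟨Sum.inl E, (toSkeleton hG hJ).participant R r E hE⟩ → G.adj a b := by
    rintro R ⟨r, hr⟩ E hE a b ha hb
    have h1 : a = r := by
      exact toInstance_injective hG hJ (ha.trans (toInstance_val hG hJ ⟨r, hr⟩).symm)
    have h2 : b = ((toSkeleton hG hJ).participant R ⟨r, hr⟩ E hE).1 := by
      exact toInstance_injective hG hJ (hb.trans (toInstance_val hG hJ _).symm)
    subst h1
    rw [h2]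
    exact adj_participant hG hJ R ⟨a, hr⟩ E hE
  have key' : ∀ (a b : G.Node) (R : S.Rel) (E : S.Ent), G.cls a = Sum.inr R →
      G.cls b = Sum.inl E → G.adj a b → ∃ (r : {x : G.Node // G.cls x = Sum.inr R})
      (hE : E ∈ S.parts R), toInstance hG hJ a = ⟨Sum.inr R, r⟩ ∧
      toInstance hG hJ b = ⟨Sum.inl E, (toSkeleton hG hJ).participant R r E hE⟩ := by
    intro a b R E ha hb hab
    have hE : E ∈ S.parts R := by
      have := G.linked hab
      rw [ha, hb] at this
      exact this
    have h1 := adj_participant hG hJ R ⟨a, ha⟩ E hE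
    have h2 := ((toSkeleton hG hJ).participant R ⟨a, ha⟩ E hE).2
    have h3 : b = ((toSkeleton hG hJ).participant R ⟨a, ha⟩ E hE).1 := by
      by_contra hne
      obtain ⟨E', R', h, -⟩ := G.turn hab h1 hne (hb.trans h2.symm)
      rw [ha] at h
      cases h
    refine ⟨⟨a, ha⟩, hE, toInstance_val hG hJ ⟨a, ha⟩, ?_⟩
    exact (congrArg _ h3).trans (toInstance_val hG hJ _)
  constructor
  · rintro ⟨R, r, E, hE, ⟨h1, h2⟩ | ⟨h1, h2⟩⟩
    · exact key R r E hE x y h1 h2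
    · exact G.symm (key R r E hE y x h1 h2)
  · intro h
    have hl := G.linked h
    rcases hx : G.cls x with E | R <;> rcases hy : G.cls y with E' | R' <;> rw [hx, hy] at hl
    · exact hl.elim
    · obtain ⟨r, hE, h1, h2⟩ := key' y x R' E hy hx (G.symm h)
      exact ⟨R', r, E, hE, Or.inr ⟨h1, h2⟩⟩
    · obtain ⟨r, hE, h1, h2⟩ := key' x y R E' hx hy h
      exact ⟨R, r, E', hE, Or.inl ⟨h1, h2⟩⟩
    · exact hl.elim

/-! ### Walks and bridge burning -/

/-- The end of a walk none of whose nodes can be reached by a shorter walk lies in the terminal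
set; version for a traversal in progress, with `n` nodes visited so far. -/
theorem mem_traverse (x : G.Node) (k : List G.Node) :
    ∀ (n : ℕ) (v : G.Node) (front burnt : Set (toSkeleton hG hJ).Instance),
    toInstance hG hJ v ∈ front → G.IsWalk (v :: k) →
    (∀ y, toInstance hG hJ y ∈ front → ∃ q, G.Walk y x q ∧ q.length = n ∧
      ∀ z ∈ q, toInstance hG hJ z ∈ burnt) →
    (∀ y, toInstance hG hJ y ∈ burnt → ∃ q, G.Walk y x q ∧ q.length ≤ n) →
    (∀ (i : ℕ) (hi : i < k.length) (q : List G.Node), G.Walk k[i] x q → n + i < q.length) →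
    ∀ y, (v :: k).getLast? = some y →
    toInstance hG hJ y ∈ (toSkeleton hG hJ).traverse (k.map G.cls) front burnt := by
  induction k with
  | nil =>
    intro n v front burnt hv _ _ _ _ y hy
    simp at hy
    subst hy
    exact hv
  | cons w k ih =>
    intro n v front burnt hv hwalk hfront hburnt hmin y hy
    obtain ⟨hvw, hwk, -⟩ := isTrail_cons_cons.1 hwalk
    rw [List.map_cons, Skeleton.traverse]
    refine ih (n + 1) w _ _ ?_ hwk ?_ ?_ ?_ y (by simpa using hy)
    · refine ⟨rfl, ⟨_, hv, (adj_toInstance hG hJ).2 hvw⟩, ?_⟩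
      intro hb
      obtain ⟨q, hq, hql⟩ := hburnt w hb
      have := hmin 0 (by simp) q hq
      omega
    · rintro z ⟨hz1, ⟨u, hu, hadj⟩, hz2⟩
      obtain ⟨u, rfl⟩ := toInstance_surjective hG hJ u
      obtain ⟨q, hq, hql, hqb⟩ := hfront u hu
      rw [adj_toInstance] at hadj
      refine ⟨z :: q, ⟨?_, rfl, ?_⟩, by simp [hql], ?_⟩
      · have := hq.head
        cases q with
        | nil => simp at this
        | cons u' q =>
          simp at this
          subst this
          refine isTrail_cons_cons.2 ⟨G.symm hadj, hq.isWalk, ?_⟩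
          -- The new node is not burnt, but all nodes of `q` are, so prepending it does not turn
          -- back.
          rintro c hc rfl
          exact hz2 (hqb z (List.mem_cons_of_mem _ (List.mem_of_mem_head? hc)))
      · have := hq.last
        cases q with
        | nil => simp at this
        | cons u' q => simpa using this
      · intro a ha
        rcases List.mem_cons.1 ha with rfl | ha
        · exact Or.inr ⟨hz1, ⟨_, hu, (adj_toInstance hG hJ).2 hadj⟩, hz2⟩
        · exact Or.inl (hqb a ha)
    · rintro z (hz | ⟨hz1, ⟨u, hu, hadj⟩, hz2⟩)
      · obtain ⟨q, hq, hql⟩ := hburnt z hz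
        exact ⟨q, hq, by omega⟩
      · obtain ⟨u, rfl⟩ := toInstance_surjective hG hJ u
        obtain ⟨q, hq, hql, hqb⟩ := hfront u hu
        rw [adj_toInstance] at hadj
        refine ⟨z :: q, ⟨?_, rfl, ?_⟩, by simp [hql]⟩
        · have := hq.head
          cases q with
          | nil => simp at this
          | cons u' q =>
            simp at this
            subst this
            refine isTrail_cons_cons.2 ⟨G.symm hadj, hq.isWalk, ?_⟩
            rintro c hc rfl
            exact hz2 (hqb z (List.mem_cons_of_mem _ (List.mem_of_mem_head? hc)))
        · have := hq.last
          cases q with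
          | nil => simp at this
          | cons u' q => simpa using this
    · intro i hi q hq
      have := hmin (i + 1) (by simpa using hi) q (by simpa using hq)
      omega

/-- Lengths count nodes: the hypothesis says that `p[i]` is at least `i` steps away from `x`, so it
is not burnt before the traversal reaches it along `p`. -/
theorem mem_terminalSet {x y : G.Node} {p : List G.Node} (hp : G.Walk x y p)
    (hmin : ∀ (i : ℕ) (hi : i < p.length) (q : List G.Node), G.Walk p[i] x q → i < q.length) :
    toInstance hG hJ y ∈ (toSkeleton hG hJ).terminalSet (toInstance hG hJ x) (p.map G.cls) := by
  obtain ⟨hpw, hph, hpl⟩ := hp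
  cases p with
  | nil => simp at hph
  | cons v k =>
    simp at hph
    subst hph
    rw [List.map_cons, Skeleton.terminalSet]
    refine mem_traverse hG hJ v k 1 v
      {y | y = toInstance hG hJ v ∧ (toInstance hG hJ v).1 = G.cls v} {toInstance hG hJ v}
      ⟨rfl, rfl⟩ hpw ?_ ?_ ?_ y hpl
    · rintro z ⟨hz, -⟩
      obtain rfl := toInstance_injective hG hJ hz
      exact ⟨[z], Walk.single z, rfl, by simp⟩
    · intro z hz
      obtain rfl := toInstance_injective hG hJ hz
      exact ⟨[z], Walk.single z, by simp⟩
    · intro i hi q hq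
      have := hmin (i + 1) (by simpa using hi) q (by simpa using hq)
      omega

end PartialSkeleton

/-! ### Completing a partial skeleton by attached trees -/

namespace PartialSkeleton

open RelationalSchema

variable {S : RelationalSchema.{u}} (B : PartialSkeleton S) {Λ : Type} (dec : Λ → S.Item)

/-- The item class of the node reached from a node of `B` by pushing letters. -/
def hullCls : B.Node → List (Λ × ℕ) → S.Item
  | v, [] => B.cls v
  | _, l :: _ => dec l.1

/-- The neighbours of a node that are not on top of it. -/
def hullLow : B.Node → List (Λ × ℕ) → Set (B.Node × List (Λ × ℕ))
  | v, [] => {m | m.2 = [] ∧ B.adj v m.1}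
  -- A letter is a class index with a copy number. Stacks with an inadmissible top letter remain as
  -- nodes but are not joined to the node below. Where only one neighbour of a class is allowed, the
  -- copy must be 0 and no lower neighbour may already have that class.
  | v, l :: s => {m | m = (v, s) ∧ S.Linked (B.hullCls dec v s) (dec l.1) ∧
      (¬ S.Branching (B.hullCls dec v s) (dec l.1) →
        l.2 = 0 ∧ ∀ k ∈ hullLow v s, B.hullCls dec k.1 k.2 ≠ dec l.1)}

variable {B dec}

theorem mem_hullLow_cases {n m : B.Node × List (Λ × ℕ)} (h : m ∈ B.hullLow dec n.1 n.2) :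
    (n.2 = [] ∧ m.2 = [] ∧ B.adj n.1 m.1) ∨ ∃ l, n = (m.1, l :: m.2) := by
  obtain ⟨v, s⟩ := n
  cases s with
  | nil => exact Or.inl ⟨rfl, h⟩
  | cons l s =>
    obtain ⟨rfl, -⟩ := h
    exact Or.inr ⟨l, rfl⟩

theorem hullLow_linked {n m : B.Node × List (Λ × ℕ)} (h : m ∈ B.hullLow dec n.1 n.2) :
    S.Linked (B.hullCls dec n.1 n.2) (B.hullCls dec m.1 m.2) := by
  obtain ⟨v, s⟩ := n
  obtain ⟨w, s'⟩ := m
  cases s with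
  | nil =>
    obtain ⟨h1, h2⟩ := h
    simp only at h1 h2
    subst h1
    exact B.linked h2
  | cons l s =>
    obtain ⟨h1, h2, -⟩ := h
    cases h1
    exact h2.symm

theorem hullLow_turn {n m m' : B.Node × List (Λ × ℕ)} (h : m ∈ B.hullLow dec n.1 n.2)
    (h' : m' ∈ B.hullLow dec n.1 n.2) (hne : m ≠ m') :
    S.Turn (B.hullCls dec m.1 m.2) (B.hullCls dec n.1 n.2) (B.hullCls dec m'.1 m'.2) := by
  obtain ⟨v, s⟩ := n
  obtain ⟨w, t⟩ := m
  obtain ⟨w', t'⟩ := m'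
  cases s with
  | nil =>
    obtain ⟨h1, h2⟩ := h
    obtain ⟨h3, h4⟩ := h'
    simp only at h1 h2 h3 h4
    subst h1 h3
    exact B.turn h2 h4 (fun h => hne (Prod.ext h rfl))
  | cons l s => exact absurd (h.1.trans h'.1.symm) hne

theorem hullLow_cons_turn {v : B.Node} {s : List (Λ × ℕ)} {l : Λ × ℕ}
    {m : B.Node × List (Λ × ℕ)} (h : (v, s) ∈ B.hullLow dec v (l :: s))
    (hm : m ∈ B.hullLow dec v s) :
    S.Turn (B.hullCls dec m.1 m.2) (B.hullCls dec v s) (dec l.1) := by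
  intro heq
  by_contra hb
  exact (h.2.2 hb).2 m hm heq

variable (B) in
/-- Trees attached to the nodes of a partial skeleton, in which every node has all the neighbours
that the cardinalities admit, infinitely many where they admit more than one. -/
def hull (hdec : Function.Injective dec) : PartialSkeleton S where
  Node := B.Node × List (Λ × ℕ)
  cls n := B.hullCls dec n.1 n.2
  adj n m := m ∈ B.hullLow dec n.1 n.2 ∨ n ∈ B.hullLow dec m.1 m.2
  symm h := h.symm
  linked := by
    rintro x y (h | h)
    · exact hullLow_linked h
    · exact (hullLow_linked h).symm
  turn := by
    -- Base edges are low from both sides, so each neighbour of `n` is either low or lies directly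
    -- on top of `n`.
    have key : ∀ n m : B.Node × List (Λ × ℕ), n ∈ B.hullLow dec m.1 m.2 →
        m ∈ B.hullLow dec n.1 n.2 ∨ ∃ l, m = (n.1, l :: n.2) := by
      intro n m h
      rcases mem_hullLow_cases h with ⟨h1, h2, h3⟩ | h
      · left
        obtain ⟨v, s⟩ := n
        simp only at h2 h3
        subst h2
        exact ⟨h1, B.symm h3⟩
      · exact Or.inr h
    intro x n y hx hy hne
    have hx' : x ∈ B.hullLow dec n.1 n.2 ∨
        ∃ l, x = (n.1, l :: n.2) ∧ n ∈ B.hullLow dec x.1 x.2 := by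
      rcases hx with h | h
      · exact Or.inl h
      · rcases key _ _ h with h' | ⟨l, h'⟩
        · exact Or.inl h'
        · exact Or.inr ⟨l, h', h⟩
    have hy' : y ∈ B.hullLow dec n.1 n.2 ∨
        ∃ l, y = (n.1, l :: n.2) ∧ n ∈ B.hullLow dec y.1 y.2 := by
      rcases hy with h | h
      · exact Or.inl h
      · rcases key _ _ h with h' | ⟨l, h'⟩
        · exact Or.inl h'
        · exact Or.inr ⟨l, h', h⟩
    rcases hx' with hx | ⟨l, rfl, hx⟩ <;> rcases hy' with hy | ⟨l', rfl, hy⟩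
    · exact hullLow_turn hx hy hne
    · exact hullLow_cons_turn hy hx
    · exact (hullLow_cons_turn hx hy).symm
    -- Two nodes on top of `n` with the same class have the same class index, as `dec` is injective.
    -- Without branching both copy numbers are 0, so the nodes coincide.
    · intro heq
      by_contra hb
      have h1 : l.1 = l'.1 := hdec heq
      have hb' : ¬ S.Branching (B.hullCls dec n.1 n.2) (dec l.1) := by rwa [h1]
      have h2 := (hx.2.2 hb').1
      have h3 := (hy.2.2 hb).1
      exact hne (by rw [Prod.ext h1 (h2.trans h3.symm)])

variable (hdec : Function.Injective dec)

/-- The height of a node of the hull over the underlying partial skeleton. -/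
def ht {hdec : Function.Injective dec} (n : (B.hull hdec).Node) : ℕ := n.2.length

/-- A node of a partial skeleton as a node of the hull. -/
def base (v : B.Node) : (B.hull hdec).Node := (v, [])

/-- With branching, infinitely many copies are available and one avoids `F`. Without it, the turn
condition says that no node of `F` has the wanted class, so any neighbour of that class will do: a
low one if there is one, otherwise copy 0 on top. -/
theorem isFull_hull (hB : ∀ v, B.cls v ∈ Set.range dec) :
    (B.hull hdec).IsFull (Set.range dec) where
  cls_mem := by
    rintro ⟨v, s⟩
    cases s with
    | nil => exact hB v
    | cons l s => exact ⟨l.1, rfl⟩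
  exists_adj := by
    rintro ⟨v, s⟩ I ⟨a, rfl⟩ hlink F hF hturn
    change S.Linked (B.hullCls dec v s) (dec a) at hlink
    by_cases hb : S.Branching (B.hullCls dec v s) (dec a)
    · have hinj : Function.Injective fun k : ℕ => ((v, (a, k) :: s) : (B.hull hdec).Node) := by
        intro k k' h
        simpa using h
      obtain ⟨_, ⟨k, rfl⟩, hk⟩ := (Set.infinite_range_of_injective hinj).exists_notMem_finite hF
      refine ⟨_, Or.inr ?_, rfl, hk⟩
      exact (⟨rfl, hlink, fun h => absurd hb h⟩ : (v, s) ∈ B.hullLow dec v ((a, k) :: s))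
    · have hFne : ∀ f ∈ F, (B.hull hdec).cls f ≠ dec a := fun f hf h => hb (hturn f hf h)
      by_cases hlow : ∃ k ∈ B.hullLow dec v s, B.hullCls dec k.1 k.2 = dec a
      · obtain ⟨k, hk, hka⟩ := hlow
        exact ⟨k, Or.inl hk, hka, fun h => hFne k h hka⟩
      · push Not at hlow
        refine ⟨(v, (a, 0) :: s), Or.inr ?_, rfl, fun h => hFne _ h rfl⟩
        exact (⟨rfl, hlink, fun _ => ⟨rfl, hlow⟩⟩ : (v, s) ∈ B.hullLow dec v ((a, 0) :: s))

variable {hdec}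

/-! ### Heights and lengths of walks in the hull -/

theorem hull_adj_cases {x y : (B.hull hdec).Node} (h : (B.hull hdec).adj x y) :
    (x.2 = [] ∧ y.2 = [] ∧ B.adj x.1 y.1) ∨ (∃ l, x = (y.1, l :: y.2)) ∨
      ∃ l, y = (x.1, l :: x.2) := by
  rcases h with h | h
  · rcases mem_hullLow_cases h with h | h
    · exact Or.inl h
    · exact Or.inr (Or.inl h)
  · rcases mem_hullLow_cases h with ⟨h1, h2, h3⟩ | h
    · exact Or.inl ⟨h2, h1, B.symm h3⟩
    · exact Or.inr (Or.inr h)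

theorem ht_le_of_adj {x y : (B.hull hdec).Node} (h : (B.hull hdec).adj x y) :
    ht x ≤ ht y + 1 := by
  rcases hull_adj_cases h with ⟨h1, h2, -⟩ | ⟨l, h⟩ | ⟨l, h⟩
  · simp [ht, h1]
  · simp [ht, h]
  · simp only [ht, h, List.length_cons]; omega

/-- The only way down from a tree node is back to its parent, so a walk that has once gone up must
keep going up. -/
theorem ht_last_of_ascend (t : List (B.hull hdec).Node) :
    ∀ (a b y : (B.hull hdec).Node) (l : Λ × ℕ), b = (a.1, l :: a.2) →
      (B.hull hdec).IsWalk (a :: b :: t) → (b :: t).getLast? = some y →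
      ht y = ht a + t.length + 1 := by
  induction t with
  | nil =>
    rintro a b y l rfl h hy
    have hy' : (a.1, l :: a.2) = y := Option.some.inj hy
    rw [← hy']
    rfl
  | cons c t ih =>
    rintro a b y l hb h hy
    obtain ⟨hab, h2, h3⟩ := isTrail_cons_cons.1 h
    obtain ⟨hbc, -, -⟩ := isTrail_cons_cons.1 h2
    rcases hull_adj_cases hbc with ⟨h4, -⟩ | ⟨l', h4⟩ | ⟨l', h4⟩
    · rw [hb] at h4; simp at h4
    · exfalso
      rw [hb] at h4
      have h5 : a.1 = c.1 := (Prod.mk.inj h4).1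
      have h6 : l :: a.2 = l' :: c.2 := (Prod.mk.inj h4).2
      exact h3 c rfl (Prod.ext h5 (List.cons.inj h6).2)
    · have := ih b c y l' h4 h2 (by simpa using hy)
      rw [this, hb]
      simp [ht]
      omega

theorem isWalk_base_iff {p : List B.Node} :
    (B.hull hdec).IsWalk (p.map (base hdec)) ↔ B.IsWalk p := by
  rw [IsWalk, isTrail_map]
  have h1 : (fun a b => (B.hull hdec).adj (base hdec a) (base hdec b)) = B.adj := by
    funext a b
    apply propext
    constructor
    · rintro (⟨-, h⟩ | ⟨-, h⟩)
      · exact h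
      · exact B.symm h
    · exact fun h => Or.inl ⟨rfl, h⟩
  have h2 : (fun (a _ c : B.Node) => base hdec a ≠ base hdec c) =
      fun a _ c => a ≠ c := by
    funext a _ c
    exact propext (not_congr ⟨fun h => congrArg Prod.fst h, fun h => congrArg _ h⟩)
  rw [h1, h2]

/-- A walk that leaves the base never comes down again. -/
theorem exists_map_base (p : List (B.hull hdec).Node) :
    ∀ x y : (B.hull hdec).Node, (B.hull hdec).Walk x y p → ht x = 0 → ht y = 0 →
      ∃ p' : List B.Node, p = p'.map (base hdec) := by
  induction p with
  | nil => exact fun _ _ _ _ _ => ⟨[], rfl⟩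
  | cons a p ih =>
    intro x y h hx hy
    obtain ⟨h1, h2, h3⟩ := h
    simp at h2
    subst h2
    have ha : a = base hdec a.1 := Prod.ext rfl (List.length_eq_zero_iff.1 hx)
    cases p with
    | nil => exact ⟨[a.1], by rw [ha]; rfl⟩
    | cons b p =>
      obtain ⟨hab, h4, -⟩ := isTrail_cons_cons.1 h1
      have hb : ht b = 0 := by
        rcases hull_adj_cases hab with ⟨-, h, -⟩ | ⟨l, h⟩ | ⟨l, h⟩
        · simp [ht, h]
        · rw [h] at hx; simp [ht] at hx
        · have := ht_last_of_ascend p a b y l h h1 (by simpa using h3)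
          omega
      obtain ⟨p', hp'⟩ := ih b y ⟨h4, rfl, by simpa using h3⟩ hb hy
      exact ⟨a.1 :: p', by rw [hp', List.map_cons, ← ha]⟩

/-- Walks with at most `L` edges between the same nodes have equally many edges. -/
def UniqueLength (B : PartialSkeleton S) (L : ℕ) : Prop :=
  ∀ x y p q, B.Walk x y p → B.Walk x y q → p.length ≤ L + 1 → q.length ≤ L + 1 →
    p.length = q.length

theorem Walk.drop_head {G : PartialSkeleton S} {x y a b : G.Node} {p : List G.Node}
    (h : G.Walk x y (a :: b :: p)) : a = x ∧ G.adj x b ∧ G.Walk b y (b :: p) := by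
  obtain ⟨h1, h2, h3⟩ := h
  simp at h2
  subst h2
  exact ⟨rfl, (isTrail_cons_cons.1 h1).1, h1.tail, rfl, by simpa using h3⟩

/-- From the higher end, if its height is positive, a walk to the other end must first step down to
the parent. Removing this common step lowers the heights and the lengths by one, until both ends lie
in the base. -/
theorem UniqueLength.hull {L : ℕ} (hL : B.UniqueLength L) :
    ∀ (h : ℕ) (x y : (B.hull hdec).Node) (p q : List (B.hull hdec).Node), ht x + ht y = h →
      (B.hull hdec).Walk x y p → (B.hull hdec).Walk x y q → p.length ≤ L + h + 1 →
      q.length ≤ L + h + 1 → p.length = q.length := by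
  have parent : ∀ (x y b : (B.hull hdec).Node) (p : List (B.hull hdec).Node),
      ht y ≤ ht x → 0 < ht x → (B.hull hdec).Walk x y (x :: b :: p) →
      b = (x.1, x.2.tail) := by
    intro x y b p hxy hx hp
    obtain ⟨-, hxb, -⟩ := hp.drop_head
    rcases hull_adj_cases hxb with ⟨h, -⟩ | ⟨l, h⟩ | ⟨l, h⟩
    · simp [ht, h] at hx
    · rw [h]; rfl
    · have := ht_last_of_ascend p x b y l h hp.isWalk (by simpa using hp.last)
      omega
  intro h
  induction h with
  | zero =>
    intro x y p q h hp hq hpl hql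
    obtain ⟨p', rfl⟩ := exists_map_base p x y hp (by omega) (by omega)
    obtain ⟨q', rfl⟩ := exists_map_base q x y hq (by omega) (by omega)
    simp only [List.length_map] at hpl hql ⊢
    have aux : ∀ r : List B.Node, (B.hull hdec).Walk x y (r.map (base hdec)) →
        B.Walk x.1 y.1 r := by
      intro r hr
      refine ⟨isWalk_base_iff.1 hr.isWalk, ?_, ?_⟩
      · have := hr.head
        rw [List.head?_map, Option.map_eq_some_iff] at this
        obtain ⟨a, ha, rfl⟩ := this
        exact ha
      · have := hr.last
        rw [List.getLast?_map, Option.map_eq_some_iff] at this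
        obtain ⟨a, ha, rfl⟩ := this
        exact ha
    exact hL _ _ _ _ (aux _ hp) (aux _ hq) (by simpa using hpl) (by simpa using hql)
  | succ h ih =>
    have main : ∀ (x y : (B.hull hdec).Node) (p q : List (B.hull hdec).Node),
        ht y ≤ ht x → ht x + ht y = h + 1 →
        (B.hull hdec).Walk x y p → (B.hull hdec).Walk x y q → p.length ≤ L + (h + 1) + 1 →
        q.length ≤ L + (h + 1) + 1 → p.length = q.length := by
      have trivialWalk : ∀ (x : (B.hull hdec).Node) (q : List (B.hull hdec).Node),
          ht x + ht x = h + 1 → (B.hull hdec).Walk x x q → q.length ≤ L + (h + 1) + 1 →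
          q.length = 1 := by
        intro x q hx hq hql
        match q, hq, hql with
        | [], hq, _ => simpa using hq.head
        | [_], _, _ => rfl
        | a :: b :: q, hq, hql =>
          exfalso
          obtain ⟨rfl, hab, hq'⟩ := hq.drop_head
          have hb := parent a a b q le_rfl (by omega) hq
          have hbt : ht b + 1 = ht a := by
            rw [hb]
            simp only [ht, List.length_tail]
            simp only [ht] at hx
            omega
          -- Comparison with the direct edge back up leaves only a walk `a, b, a`, which turns back.
          have := ih b a (b :: q) [b, a] (by omega) hq' ⟨(B.hull hdec).symm hab, rfl, rfl⟩
            (by simp at hql ⊢; omega) (by simp; omega)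
          match q, this with
          | [c], _ =>
            have hl := hq.last
            simp at hl
            subst hl
            exact (isTrail_cons_cons.1 hq.isWalk).2.2 c rfl rfl
      intro x y p q hyx hxy hp hq hpl hql
      match p, hp, hpl, q, hq, hql with
      | [], hp, _, _, _, _ => simpa using hp.head
      | _, _, _, [], hq, _ => simpa using hq.head
      | [a], hp, _, q, hq, hql =>
        have h1 := hp.head
        have h2 := hp.last
        simp at h1 h2
        subst h1 h2
        exact (trivialWalk a q hxy hq hql).symm
      | p, hp, hpl, [a], hq, _ =>
        have h1 := hq.head
        have h2 := hq.last
        simp at h1 h2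
        subst h1 h2
        exact trivialWalk a p hxy hp hpl
      | a :: b :: p, hp, hpl, a' :: b' :: q, hq, hql =>
        obtain ⟨rfl, hab, hp'⟩ := hp.drop_head
        obtain ⟨rfl, hab', hq'⟩ := hq.drop_head
        have hb := parent _ y b p hyx (by omega) hp
        have hb' := parent _ y b' q hyx (by omega) hq
        subst hb'
        subst hb
        have hbt : ht (hdec := hdec) (a'.1, a'.2.tail) + 1 = ht a' := by
          simp only [ht, List.length_tail]
          simp only [ht] at hxy hyx
          omega
        have := ih _ y _ _ (by omega) hp' hq' (by simp at hpl ⊢; omega) (by simp at hql ⊢; omega)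
        simpa using this
    intro x y p q hxy hp hq hpl hql
    rcases le_total (ht y) (ht x) with hle | hle
    · exact main x y p q hle hxy hp hq hpl hql
    · have := main y x p.reverse q.reverse hle (by omega) hp.reverse hq.reverse (by simpa using hpl)
        (by simpa using hql)
      simpa using this

/-- Height rises by at most one per step, and `p.length - 1 - i` steps remain after `p[i]`. This
bounds from below the height of the intermediate node, as `UniqueLength.hull` requires for initial
segments. -/
theorem ht_take {p : List (B.hull hdec).Node} {x y : (B.hull hdec).Node}
    (hp : (B.hull hdec).Walk x y p) (i : ℕ) (hi : i < p.length) :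
    ht y + i + 1 ≤ ht p[i] + p.length := by
  have hadj : ∀ i (hi : i + 1 < p.length), ht p[i + 1] ≤ ht p[i] + 1 := by
    intro i hi
    exact ht_le_of_adj ((B.hull hdec).symm (hp.isWalk.getElem i hi).1)
  have key : ∀ j (hj : i + j < p.length), ht p[i + j] ≤ ht p[i] + j := by
    intro j
    induction j with
    | zero => simp
    | succ j ih =>
      intro hj
      have h1 := ih (by omega)
      have h2 := hadj (i + j) (by omega)
      have h3 : p[i + (j + 1)] = p[i + j + 1] := rfl
      rw [h3]
      omega
  have hl := hp.last
  rw [List.getLast?_eq_getElem?, List.getElem?_eq_some_iff] at hl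
  obtain ⟨h1, h2⟩ := hl
  have h3 := key (p.length - 1 - i) (by omega)
  have h4 : i + (p.length - 1 - i) = p.length - 1 := by omega
  simp only [h4] at h3
  rw [h2] at h3
  omega

theorem Walk.take {G : PartialSkeleton S} {p : List G.Node} {x y : G.Node} (hp : G.Walk x y p)
    (i : ℕ) (hi : i < p.length) : G.Walk x p[i] (p.take (i + 1)) := by
  refine ⟨?_, ?_, ?_⟩
  · have := hp.isWalk
    rw [← List.take_append_drop (i + 1) p] at this
    exact this.prefix
  · rw [List.head?_take]
    simpa using hp.head
  · rw [List.getLast?_eq_getElem?, List.length_take, min_eq_left (by omega)]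
    simp [hi]

/-- In the hull, the end of a sufficiently short walk lies in the terminal set of the path. -/
theorem UniqueLength.mem_terminalSet {L : ℕ} (hL : B.UniqueLength L)
    {J : Set S.Item} (hG : (B.hull hdec).IsFull J)
    (hJ : ∀ R, Sum.inr R ∈ J → ∀ E ∈ S.parts R, Sum.inl E ∈ J)
    {x y : (B.hull hdec).Node} {p : List (B.hull hdec).Node} (hp : (B.hull hdec).Walk x y p)
    (hpl : p.length ≤ L + (ht x + ht y) + 1) :
    toInstance hG hJ y ∈
      (toSkeleton hG hJ).terminalSet (toInstance hG hJ x) (p.map (B.hull hdec).cls) := by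
  refine PartialSkeleton.mem_terminalSet hG hJ hp ?_
  intro i hi q hq
  by_contra hlt
  have h1 := ht_take hp i hi
  have h2 := hp.take i hi
  have h3 : (p.take (i + 1)).length = i + 1 := by simp; omega
  have h4 : q.length ≤ i := by omega
  have := hL.hull (hdec := hdec) _ x p[i] _ _ rfl h2 hq.reverse (by omega) (by simp; omega)
  rw [h3, List.length_reverse] at this
  omega

end PartialSkeleton

open RelationalSchema

/-! ### Finite sets of item classes -/

namespace RelationalSchema

variable {S : RelationalSchema.{u}}

/-- Finitely many item classes can be enumerated together with all participants of the relationship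
classes among them. -/
theorem exists_enumeration (l : List S.Item) :
    ∃ (n : ℕ) (dec : Fin n → S.Item), Function.Injective dec ∧ (∀ I ∈ l, I ∈ Set.range dec) ∧
      ∀ R, Sum.inr R ∈ Set.range dec → ∀ E ∈ S.parts R, Sum.inl E ∈ Set.range dec := by
  classical
  let parts : S.Item → Finset S.Item := fun I =>
    Sum.elim (fun _ => ∅) (fun R => (S.parts R).image Sum.inl) I
  let J : Finset S.Item := l.toFinset ∪ l.toFinset.biUnion parts
  have hr : Set.range (fun i => (J.equivFin.symm i : S.Item)) = J := by
    ext I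
    constructor
    · rintro ⟨i, rfl⟩
      exact (J.equivFin.symm i).2
    · intro h
      exact ⟨J.equivFin ⟨I, h⟩, by simp⟩
  refine ⟨J.card, fun i => (J.equivFin.symm i : S.Item), ?_, ?_, ?_⟩
  · exact Subtype.val_injective.comp J.equivFin.symm.injective
  · intro I hI
    rw [hr]
    simp [J, hI]
  · intro R hR E hE
    rw [hr] at hR ⊢
    have hRl : Sum.inr R ∈ l := by
      simp only [J, Finset.coe_union, Set.mem_union, Finset.mem_coe, List.mem_toFinset,
        Finset.mem_biUnion] at hR
      rcases hR with h | ⟨I, -, hI⟩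
      · exact h
      · cases I <;> simp [parts] at hI
    simp only [J, Finset.coe_union, Set.mem_union, Finset.mem_coe, List.mem_toFinset,
      Finset.mem_biUnion]
    exact Or.inr ⟨_, hRl, by simpa [parts] using hE⟩

end RelationalSchema

namespace PartialSkeleton

variable {S : RelationalSchema.{u}}

/-! ### Single points and circles -/

/-- The partial skeleton with a single instance. -/
def point (I : S.Item) : PartialSkeleton S where
  Node := Unit
  cls _ := I
  adj _ _ := False
  symm h := h
  linked h := h.elim
  turn h := h.elim

theorem uniqueLength_point (I : S.Item) (L : ℕ) : (point I).UniqueLength L := by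
  have : ∀ x y p, (point I).Walk x y p → p.length = 1 := by
    intro x y p hp
    match p, hp with
    | [], hp => simpa using hp.head
    | [_], _ => rfl
    | _ :: _ :: _, hp => exact hp.drop_head.2.1.elim
  intro x y p q hp hq _ _
  rw [this x y p hp, this x y q hq]

/-- The circle of `M` nodes whose item classes are the values of an `M`-periodic sequence. -/
abbrev circle (f : ℕ → S.Item) (M : ℕ) [NeZero M] (hper : Function.Periodic f M)
    (hlink : ∀ n, S.Linked (f n) (f (n + 1)))
    (hturn : ∀ n, S.Turn (f n) (f (n + 1)) (f (n + 2))) : PartialSkeleton S where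
  Node := ZMod M
  cls k := f k.val
  adj a b := b = a + 1 ∨ a = b + 1
  symm h := h.symm
  linked := by
    have key : ∀ a : ZMod M, S.Linked (f a.val) (f (a + 1).val) := by
      intro a
      have : ((a.val + 1 : ℕ) : ZMod M) = a + 1 := by simp
      rw [← this, ZMod.val_natCast, hper.map_mod_nat]
      exact hlink _
    rintro a b (rfl | rfl)
    · exact key a
    · exact (key b).symm
  turn := by
    have key : ∀ a : ZMod M, S.Turn (f a.val) (f (a + 1).val) (f (a + 1 + 1).val) := by
      intro a
      have h1 : ((a.val + 1 : ℕ) : ZMod M) = a + 1 := by simp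
      have h2 : ((a.val + 2 : ℕ) : ZMod M) = a + 1 + 1 := by
        push_cast
        rw [ZMod.natCast_zmod_val]
        ring
      rw [← h1, h1, ← h2, ← h1, ZMod.val_natCast, hper.map_mod_nat, ZMod.val_natCast,
        hper.map_mod_nat]
      exact hturn _
    rintro x y z (rfl | rfl) (rfl | h) hne
    · exact absurd rfl hne
    · subst h
      exact (key z).symm
    · exact key x
    · exact absurd (add_right_cancel h) hne

/-- The walk of `n` steps around the circle in the positive direction. -/
def arc (M : ℕ) : ℕ → ℕ → List (ZMod M)
  | k, 0 => [(k : ZMod M)]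
  | k, n + 1 => (k : ZMod M) :: arc M (k + 1) n

theorem arc_eq_cons {M : ℕ} (k n : ℕ) : ∃ t, arc M k n = (k : ZMod M) :: t := by
  cases n <;> exact ⟨_, rfl⟩

theorem length_arc {M : ℕ} (n k : ℕ) : (arc M k n).length = n + 1 := by
  induction n generalizing k with
  | zero => rfl
  | succ n ih => rw [arc, List.length_cons, ih]

section Circle

variable {f : ℕ → S.Item} {M : ℕ} [NeZero M] {hper : Function.Periodic f M}
  {hlink : ∀ n, S.Linked (f n) (f (n + 1))}
  {hturn : ∀ n, S.Turn (f n) (f (n + 1)) (f (n + 2))}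

theorem circle_walk_forward (t : List (ZMod M)) :
    ∀ a b y : ZMod M, b = a + 1 → (circle f M hper hlink hturn).IsWalk (a :: b :: t) →
      (b :: t).getLast? = some y → y = a + (t.length + 1 : ℕ) := by
  induction t with
  | nil =>
    intro a b y hb _ hy
    simp at hy
    rw [← hy, hb]
    simp
  | cons c t ih =>
    intro a b y hb h hy
    obtain ⟨-, h2, h3⟩ := isTrail_cons_cons.1 h
    obtain ⟨hbc, -, -⟩ := isTrail_cons_cons.1 h2
    rcases hbc with hbc | hbc
    · rw [ih b c y hbc h2 (by simpa using hy), hb, List.length_cons]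
      push_cast
      ring
    · exact absurd (add_right_cancel (hb.symm.trans hbc)) (h3 c rfl)

theorem circle_walk_backward (t : List (ZMod M)) :
    ∀ a b y : ZMod M, a = b + 1 → (circle f M hper hlink hturn).IsWalk (a :: b :: t) →
      (b :: t).getLast? = some y → a = y + (t.length + 1 : ℕ) := by
  induction t with
  | nil =>
    intro a b y hb _ hy
    simp at hy
    rw [← hy, hb]
    simp
  | cons c t ih =>
    intro a b y hb h hy
    obtain ⟨-, h2, h3⟩ := isTrail_cons_cons.1 h
    obtain ⟨hbc, -, -⟩ := isTrail_cons_cons.1 h2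
    rcases hbc with hbc | hbc
    · exact absurd (hb.trans hbc.symm) (h3 c rfl)
    · have := ih b c y hbc h2 (by simpa using hy)
      rw [hb, this, List.length_cons]
      push_cast
      ring

theorem circle_walk {x y : ZMod M} {p : List (ZMod M)}
    (hp : (circle f M hper hlink hturn).Walk x y p) :
    ∃ n : ℕ, p.length = n + 1 ∧ (y = x + n ∨ x = y + n) := by
  match p, hp with
  | [], hp => exact absurd hp.head (by simp)
  | [a], hp =>
    have h1 := hp.head
    have h2 := hp.last
    simp at h1 h2
    exact ⟨0, rfl, by simp [← h1, ← h2]⟩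
  | a :: b :: t, hp =>
    obtain ⟨rfl, hab, -⟩ := hp.drop_head
    refine ⟨t.length + 1, rfl, ?_⟩
    rcases hab with h | h
    · exact Or.inl (circle_walk_forward t a b y h hp.isWalk (by simpa using hp.last))
    · exact Or.inr (circle_walk_backward t a b y h hp.isWalk (by simpa using hp.last))

theorem uniqueLength_circle {L : ℕ} (hL : 2 * L ≤ M) :
    (circle f M hper hlink hturn).UniqueLength L := by
  have hM : M ≠ 0 := NeZero.ne M
  have h1 : ∀ a b : ℕ, a ≤ L → b ≤ L → (a : ZMod M) = b → a = b := by
    intro a b ha hb h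
    by_cases haM : a < M ∧ b < M
    · rw [ZMod.natCast_eq_natCast_iff', Nat.mod_eq_of_lt haM.1, Nat.mod_eq_of_lt haM.2] at h
      exact h
    · omega
  have h2 : ∀ a b : ℕ, a ≤ L → b ≤ L → ((a + b : ℕ) : ZMod M) = 0 → a = b := by
    intro a b ha hb h
    rw [ZMod.natCast_eq_zero_iff] at h
    obtain ⟨c, hc⟩ := h
    rcases c with _ | _ | c
    · omega
    · omega
    -- Opposite directions meet after `a + b = M` steps only if `a = b = L` and `M = 2 * L`; larger
    -- multiples of `M` are out of reach.
    · have : M * (c + 1 + 1) = M * c + 2 * M := by ring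
      have := Nat.zero_le (M * c)
      omega
  intro (x : ZMod M) (y : ZMod M) (p : List (ZMod M)) (q : List (ZMod M)) hp hq hpl hql
  obtain ⟨n, hn, hn'⟩ := circle_walk hp
  obtain ⟨m, hm, hm'⟩ := circle_walk hq
  have : n = m := by
    rcases hn' with rfl | rfl <;> rcases hm' with h | h
    · exact h1 _ _ (by omega) (by omega) (add_left_cancel h)
    · apply h2 _ _ (by omega) (by omega)
      rw [add_assoc] at h
      push_cast
      exact left_eq_add.1 h
    · apply h2 _ _ (by omega) (by omega)
      rw [add_assoc] at h
      push_cast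
      exact left_eq_add.1 h
    · exact h1 _ _ (by omega) (by omega) (add_left_cancel h)
  omega

/-- Three nodes suffice to keep `k` and `k + 2` apart, so the arc does not turn back. -/
theorem arc_walk (hM : 3 ≤ M) (n k : ℕ) :
    (circle f M hper hlink hturn).Walk (k : ZMod M) ((k + n : ℕ) : ZMod M) (arc M k n) := by
  induction n generalizing k with
  | zero => exact Walk.single (G := circle f M hper hlink hturn) (k : ZMod M)
  | succ n ih =>
    have h := ih (k + 1)
    obtain ⟨t, ht⟩ := arc_eq_cons (M := M) (k + 1) n
    refine ⟨?_, rfl, ?_⟩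
    · have h1 := h.isWalk
      rw [arc]
      rw [ht] at h1 ⊢
      refine isTrail_cons_cons.2 ⟨Or.inl (by push_cast; rfl), h1, ?_⟩
      intro c hc
      have hc' : c = ((k + 1 + 1 : ℕ) : ZMod M) := by
        cases n with
        | zero =>
          rw [arc] at ht
          cases ht
          exact absurd hc (by simp)
        | succ n =>
          obtain ⟨t', ht'⟩ := arc_eq_cons (M := M) (k + 1 + 1) n
          rw [arc, ht'] at ht
          cases ht
          exact (Option.some.inj hc).symm
      rw [hc']
      intro heq
      have h3 : ((k + 0 : ℕ) : ZMod M) = ((k + 2 : ℕ) : ZMod M) := by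
        rw [add_zero, show k + 2 = k + 1 + 1 from rfl]
        exact heq
      rw [ZMod.natCast_eq_natCast_iff] at h3
      have h4 := Nat.ModEq.add_left_cancel' k h3
      have h5 := Nat.ModEq.eq_of_lt_of_lt h4 (by omega) (by omega)
      omega
    · have h2 := h.last
      rw [arc, show k + (n + 1) = k + 1 + n by ring]
      rw [ht] at h2 ⊢
      simpa using h2

theorem circle_cls_natCast (k : ℕ) :
    (circle f M hper hlink hturn).cls (k : ZMod M) = f k := by
  change f (k : ZMod M).val = f k
  rw [ZMod.val_natCast, hper.map_mod_nat]

theorem map_cls_arc (n k : ℕ) :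
    (arc M k n).map (circle f M hper hlink hturn).cls = (List.range' k (n + 1)).map f := by
  induction n generalizing k with
  | zero => simp [arc, hper.map_mod_nat]
  | succ n ih => rw [arc, List.map_cons, ih, circle_cls_natCast]; rfl

theorem circle_adj_cls {k : ℕ} {w : ZMod M}
    (h : (circle f M hper hlink hturn).adj ((k + 1 : ℕ) : ZMod M) w) :
    (circle f M hper hlink hturn).cls w = f k ∨
      (circle f M hper hlink hturn).cls w = f (k + 2) := by
  rcases h with h | h
  · right
    rw [← circle_cls_natCast (hper := hper) (hlink := hlink) (hturn := hturn), h]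
    congr 1
    push_cast
    ring
  · left
    rw [← circle_cls_natCast (hper := hper) (hlink := hlink) (hturn := hturn)]
    congr 1
    push_cast at h
    exact (add_right_cancel h).symm

end Circle

/-! ### Cyclic sequences of item classes -/

section Cyclic

variable {α : Type*} {G : List α} (hG : 0 < G.length)

/-- The periodic sequence repeating a nonempty list. -/
def cyclic (n : ℕ) : α := G[n % G.length]'(Nat.mod_lt _ hG)

theorem cyclic_periodic (N : ℕ) : Function.Periodic (cyclic hG) (N * G.length) := by
  intro n
  simp [cyclic]

theorem cyclic_eq_getElem (i : ℕ) (hi : i < (G ++ G).length) : cyclic hG i = (G ++ G)[i] := by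
  rw [cyclic, List.getElem_append]
  split
  · next h => simp [Nat.mod_eq_of_lt h]
  · next h =>
    have h1 : i % G.length = i - G.length := by
      rw [Nat.mod_eq_sub_mod (by omega), Nat.mod_eq_of_lt]
      rw [List.length_append] at hi
      omega
    simp [h1]

/-- Two copies of `G` suffice to read segments that run across its end. -/
theorem map_cyclic {A H C : List α} (h : G ++ G = A ++ H ++ C) (j : ℕ) :
    (List.range' (j * G.length + A.length) H.length).map (cyclic hG) = H := by
  apply List.ext_getElem
  · simp
  · intro i h1 h2
    simp only [List.getElem_map, List.getElem_range', one_mul]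
    have h3 : cyclic hG (j * G.length + A.length + i) = cyclic hG (A.length + i) := by
      simp [cyclic, add_assoc]
    rw [h3, cyclic_eq_getElem hG (A.length + i) (by rw [h]; simp; omega)]
    simp only [h]
    rw [List.getElem_append_left (by simp; omega), List.getElem_append_right (by omega)]
    simp

theorem cyclic_eq {A C : List α} {a : α} (h : G ++ G = A ++ a :: C) (j : ℕ) :
    cyclic hG (j * G.length + A.length) = a := by
  have := map_cyclic hG (A := A) (H := [a]) (C := C) (by simpa using h) j
  simpa using this

theorem cyclic_trail {r : α → α → Prop} {t : α → α → α → Prop} (h : IsTrail r t (G ++ G))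
    (h2 : 2 ≤ G.length) (n : ℕ) :
    r (cyclic hG n) (cyclic hG (n + 1)) ∧
      t (cyclic hG n) (cyclic hG (n + 1)) (cyclic hG (n + 2)) := by
  have hn := Nat.mod_lt n hG
  have hmod : ∀ k, cyclic hG (n + k) = cyclic hG (n % G.length + k) := by
    intro k
    simp [cyclic]
  have h0 := hmod 0
  simp only [add_zero] at h0
  have hl : (G ++ G).length = 2 * G.length := by simp; omega
  rw [h0, hmod 1, hmod 2, cyclic_eq_getElem hG _ (by omega), cyclic_eq_getElem hG _ (by omega),
    cyclic_eq_getElem hG _ (by omega)]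
  have := h.getElem (n % G.length) (by omega)
  exact ⟨this.1, this.2 (by omega)⟩

end Cyclic

/-! ### Tails attached to a circle -/

section Tail

variable {B : PartialSkeleton S} {Λ : Type} {dec : Λ → S.Item} {hdec : Function.Injective dec}

theorem hull_cls_base (v : B.Node) : (B.hull hdec).cls (base hdec v) = B.cls v := rfl

theorem map_cls_map_base (p : List B.Node) :
    (p.map (base hdec)).map (B.hull hdec).cls = p.map B.cls := by
  simp [hull_cls_base]

/-- A walk starting at a base node and avoiding its neighbours in the base ends at a height equal
to its length. -/
theorem exists_tail (hB : ∀ v, B.cls v ∈ Set.range dec) (v : B.Node)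
    (hfin : {w | B.adj v w}.Finite) (Q : List S.Item) (hQ : ∀ I ∈ Q, I ∈ Set.range dec)
    (htrail : IsTrail S.Linked S.Turn (B.cls v :: Q))
    (hturn : ∀ w, B.adj v w → ∀ I ∈ Q.head?, S.Turn (B.cls w) (B.cls v) I) :
    ∃ (k : List (B.hull hdec).Node) (y : (B.hull hdec).Node),
      k.map (B.hull hdec).cls = Q ∧ (B.hull hdec).Walk (base hdec v) y (base hdec v :: k) ∧
      ht y = Q.length ∧ ∀ b ∈ k.head?, ∀ w, b ≠ base hdec w := by
  obtain ⟨k, hk, hw, hF⟩ := (isFull_hull hdec hB).exists_walk Q (base hdec v)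
    (base hdec '' {w | B.adj v w}) (hfin.image _) hQ htrail (by
      rintro _ ⟨w, hw, rfl⟩ I hI
      exact hturn w hw I hI)
  obtain ⟨y, hy⟩ : ∃ y, (base hdec v :: k).getLast? = some y :=
    ⟨_, List.getLast?_eq_getLast_of_ne_nil (by simp)⟩
  have hbase : ∀ b ∈ k.head?, ∀ w, b ≠ base hdec w := by
    rintro b hb w rfl
    apply hF _ hb
    cases k with
    | nil => simp at hb
    | cons c k =>
      simp only [List.head?_cons, Option.mem_def, Option.some.injEq] at hb
      subst hb
      refine ⟨w, ?_, rfl⟩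
      have := (isTrail_cons_cons.1 hw).1
      rcases hull_adj_cases this with ⟨-, -, h⟩ | ⟨l, h⟩ | ⟨l, h⟩
      · exact h
      · exact absurd (Prod.mk.inj h).2.symm (List.cons_ne_nil _ _)
      · exact absurd (Prod.mk.inj h).2.symm (List.cons_ne_nil _ _)
  refine ⟨k, y, hk, ⟨hw, rfl, hy⟩, ?_, hbase⟩
  cases k with
  | nil =>
    simp only [List.getLast?_singleton, Option.some.injEq] at hy
    subst hy
    subst hk
    rfl
  | cons b k =>
    subst hk
    have hadj := (isTrail_cons_cons.1 hw).1
    rcases hull_adj_cases hadj with ⟨-, h, -⟩ | ⟨l, h⟩ | ⟨l, h⟩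
    · exact absurd (Prod.ext rfl h : b = base hdec b.1) (hbase b rfl b.1)
    · exact absurd (Prod.mk.inj h).2.symm (List.cons_ne_nil _ _)
    · rw [ht_last_of_ascend k _ b y l h hw (by simpa using hy)]
      simp [ht, base]

/-- A walk in the base with tails at both ends. -/
theorem Walk.with_tails {v w : B.Node} {p : List B.Node} (hp : B.Walk v w p) (h2 : 2 ≤ p.length)
    {x y : (B.hull hdec).Node} {k k' : List (B.hull hdec).Node}
    (hk : (B.hull hdec).Walk (base hdec v) x (base hdec v :: k))
    (hk' : (B.hull hdec).Walk (base hdec w) y (base hdec w :: k'))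
    (hkb : ∀ b ∈ k.head?, ∀ u, b ≠ base hdec u) (hkb' : ∀ b ∈ k'.head?, ∀ u, b ≠ base hdec u) :
    (B.hull hdec).Walk x y (k.reverse ++ p.map (base hdec) ++ k') := by
  obtain ⟨hpw, hpv, hpl⟩ := hp
  have hbw := (isWalk_base_iff (hdec := hdec)).2 hpw
  obtain ⟨p0, rfl⟩ : ∃ p0, p = v :: p0 := by
    cases p with
    | nil => simp at hpv
    | cons a p0 => simp at hpv; subst hpv; exact ⟨p0, rfl⟩
  have hleft : (B.hull hdec).IsWalk (k.reverse ++ base hdec v :: p0.map (base hdec)) := by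
    refine isTrail_junction.2 ⟨?_, hbw, ?_⟩
    · simpa using isWalk_reverse hk.isWalk
    · intro a ha d hd
      rw [List.getLast?_reverse] at ha
      simp only [List.head?_map, Option.mem_def, Option.map_eq_some_iff] at hd
      obtain ⟨u, -, rfl⟩ := hd
      exact hkb a ha u
  obtain ⟨p1, hp1⟩ : ∃ p1, p0 = p1 ++ [w] := by
    rcases List.eq_nil_or_concat p0 with rfl | ⟨p1, w', rfl⟩
    · simp at h2
    · rw [List.concat_eq_append] at hpl ⊢
      rw [← List.cons_append, List.getLast?_concat] at hpl
      cases hpl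
      exact ⟨p1, rfl⟩
  subst hp1
  refine ⟨?_, ?_, ?_⟩
  · have heq : k.reverse ++ (v :: (p1 ++ [w])).map (base hdec) ++ k' =
        (k.reverse ++ base hdec v :: p1.map (base hdec)) ++ base hdec w :: k' := by simp
    rw [heq]
    refine isTrail_junction.2 ⟨?_, hk'.isWalk, ?_⟩
    · simpa using hleft
    · intro a ha d hd hne
      have : ∃ u, a = base hdec u := by
        rw [List.getLast?_append] at ha
        have h3 : (base hdec v :: p1.map (base hdec)) = (v :: p1).map (base hdec) := rfl
        rw [h3, List.getLast?_map,
          List.getLast?_eq_getLast_of_ne_nil (List.cons_ne_nil v p1)] at ha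
        simp only [Option.map_some, Option.some_or, Option.mem_def, Option.some.injEq] at ha
        exact ⟨_, ha.symm⟩
      obtain ⟨u, rfl⟩ := this
      exact hkb' d hd u hne.symm
  · have h1 := hk.reverse.head
    simp only [List.reverse_cons] at h1
    have heq : k.reverse ++ (v :: (p1 ++ [w])).map (base hdec) ++ k' =
        (k.reverse ++ [base hdec v]) ++ ((p1 ++ [w]).map (base hdec) ++ k') := by simp
    rw [heq, List.head?_append, h1]
    rfl
  · have heq : k.reverse ++ (v :: (p1 ++ [w])).map (base hdec) ++ k' =
        (k.reverse ++ base hdec v :: p1.map (base hdec)) ++ base hdec w :: k' := by simp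
    rw [heq, List.getLast?_append, hk'.last]
    rfl

end Tail

end PartialSkeleton

open RelationalSchema PartialSkeleton

/-! ### Intersecting paths -/

/-- Distinct relational paths of the same length between the same item classes have intersecting
terminal sets in some skeleton. -/
theorem exists_common_terminal {S : RelationalSchema.{u}} {A A' : List S.Item} (hA : S.IsPath A)
    (hA' : S.IsPath A') (hne : A ≠ A') (hlen : A.length = A'.length)
    (hhead : A.head? = A'.head?) (hlast : A.getLast? = A'.getLast?) :
    ∃ (σ : Skeleton S) (b : σ.Instance),
      (σ.terminalSet b A ∩ σ.terminalSet b A').Nonempty := by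
  obtain ⟨n, dec, hdec, hrange, hclosed⟩ := exists_enumeration (A ++ A')
  obtain ⟨Z, z, X, X', d, D, rfl, rfl, hXX', hX, hX', hhd, hlt⟩ :=
    exists_fork hne hlen hhead hlast
  have hAt := (isPath_iff.1 hA).2
  have hAt' := (isPath_iff.1 hA').2
  obtain ⟨a, X1, hXa⟩ := List.exists_cons_of_ne_nil hX
  obtain ⟨a', X1', hXa'⟩ := List.exists_cons_of_ne_nil hX'
  obtain ⟨X2, e, hXe⟩ := (List.eq_nil_or_concat X).resolve_left hX
  obtain ⟨X2', e', hXe'⟩ := (List.eq_nil_or_concat X').resolve_left hX'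
  rw [List.concat_eq_append] at hXe hXe'
  have haa' : a ≠ a' := hhd a (by simp [hXa]) a' (by simp [hXa'])
  have hee' : e ≠ e' := hlt e (by simp [hXe]) e' (by simp [hXe'])
  -- Go out along `X` and back along `X'`. The first classes differ, and so do the last ones, so the
  -- turns at `z` and `d` are admissible.
  set G : List S.Item := z :: (X ++ d :: X'.reverse) with hGdef
  have hG : 0 < G.length := by simp [hGdef]
  have hGlen : G.length = 2 * (X.length + 1) := by simp [hGdef]; omega
  have hXpos : 0 < X.length := List.length_pos_iff.2 hX
  have hseg : IsTrail S.Linked S.Turn ((z :: X) ++ [d]) := by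
    have h1 : IsTrail S.Linked S.Turn ((z :: X) ++ d :: D) := hAt.right
    exact h1.left
  have hseg' : IsTrail S.Linked S.Turn (d :: (X'.reverse ++ [z])) := by
    have h1 : IsTrail S.Linked S.Turn ((z :: X') ++ d :: D) := hAt'.right
    simpa using itemTrail_reverse h1.left
  have hround : IsTrail S.Linked S.Turn ((z :: X) ++ d :: (X'.reverse ++ [z])) := by
    refine isTrail_junction.2 ⟨hseg, hseg', ?_⟩
    intro u hu v hv
    have hu' : e = u := by simpa [hXe, List.getLast?_cons] using hu
    have hv' : e' = v := by simpa [hXe'] using hv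
    subst hu' hv'
    exact turn_of_ne hee'
  have hGG : IsTrail S.Linked S.Turn (G ++ G) := by
    have h1 : G ++ G = G ++ z :: (X ++ d :: X'.reverse) := rfl
    have h2 : (z :: X) ++ d :: (X'.reverse ++ [z]) = G ++ [z] := by simp [hGdef]
    rw [h1]
    rw [h2] at hround
    refine isTrail_junction.2 ⟨hround, hround.prefix, ?_⟩
    intro u hu v hv
    have hu' : a' = u := by
      simpa [hGdef, hXa', List.getLast?_cons, List.getLast?_append] using hu
    have hv' : a = v := by simpa [hXa] using hv
    subst hu' hv'
    exact turn_of_ne haa'.symm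
  have : NeZero G.length := ⟨by omega⟩
  have hper : Function.Periodic (cyclic hG) G.length := by
    simpa using cyclic_periodic hG 1
  have hcyc := cyclic_trail hG hGG (by omega)
  let B := circle (cyclic hG) G.length hper (fun n => (hcyc n).1) (fun n => (hcyc n).2)
  have hfin : ∀ v : B.Node, {w | B.adj v w}.Finite := fun v =>
    Set.toFinite (α := ZMod G.length) _
  have hB : ∀ v, B.cls v ∈ Set.range dec := by
    intro v
    have h1 : B.cls v ∈ G := List.getElem_mem _
    apply hrange
    simp only [hGdef, List.mem_cons, List.mem_append, List.mem_reverse] at h1 ⊢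
    tauto
  -- The circle has exactly `2 * L` nodes, with `z` and `d` opposite each other, so both arcs
  -- between them are shortest and neither is burnt by the other.
  set L := X.length + 1 with hL
  -- The node of `z` is written as `G.length` instead of 0, so that it has a predecessor among the
  -- natural numbers.
  have hz : B.cls ((G.length : ℕ) : ZMod G.length) = z := by
    have h2 := cyclic_eq hG (A := []) (a := z) (C := X ++ d :: X'.reverse ++ G) (by simp [hGdef]) 1
    simp only [one_mul, List.length_nil, add_zero] at h2
    exact (circle_cls_natCast _).trans h2
  have hd : B.cls ((L : ℕ) : ZMod G.length) = d := by
    have h2 := cyclic_eq hG (A := z :: X) (a := d) (C := X'.reverse ++ G) (by simp [hGdef]) 0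
    simp only [zero_mul, zero_add, List.length_cons] at h2
    exact (circle_cls_natCast _).trans h2
  have hUL : B.UniqueLength L := uniqueLength_circle (by omega)
  have hfull := isFull_hull hdec hB
  obtain ⟨kZ, b, hkZ, hwZ, hhtZ, hbZ⟩ := exists_tail (hdec := hdec) hB
    ((G.length : ℕ) : ZMod G.length) (hfin _) Z.reverse
    (fun I hI => hrange I (by simp at hI; simp [hI]))
    (by
      rw [hz]
      simpa using itemTrail_reverse hAt.left)
    (by
      intro w hw I hI
      rw [hz]
      have hk : G.length = (G.length - 1) + 1 := by omega
      have hw' : B.adj (((G.length - 1) + 1 : ℕ) : ZMod G.length) w := by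
        rw [← hk]; exact hw
      rw [List.head?_reverse] at hI
      rcases circle_adj_cls hw' with h | h
      · have h2 := cyclic_eq hG (A := z :: (X ++ d :: X1'.reverse)) (a := a') (C := G)
          (by simp [hGdef, hXa']) 0
        have h3 : 0 * G.length + (z :: (X ++ d :: X1'.reverse)).length = G.length - 1 := by
          rw [hGlen]
          have : X'.length = X1'.length + 1 := by rw [hXa']; rfl
          simp
          omega
        rw [h3] at h2
        have h4 : B.cls w = a' := h.trans h2
        rw [h4]
        exact ((isTrail_junction.1 hAt').2.2 I hI a' (by simp [hXa'])).symm
      · have h2 := cyclic_eq hG (A := [z]) (a := a) (C := X1 ++ d :: X'.reverse ++ G)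
          (by simp [hGdef, hXa]) 1
        have h3 : 1 * G.length + [z].length = G.length - 1 + 2 := by
          simp
          omega
        rw [h3] at h2
        have h4 : B.cls w = a := h.trans h2
        rw [h4]
        exact ((isTrail_junction.1 hAt).2.2 I hI a (by simp [hXa])).symm)
  have hAd : IsTrail S.Linked S.Turn ((Z ++ z :: X) ++ d :: D) := by simpa using hAt
  have hAd' : IsTrail S.Linked S.Turn ((Z ++ z :: X') ++ d :: D) := by simpa using hAt'
  obtain ⟨kD, y, hkD, hwD, hhtD, hbD⟩ := exists_tail (hdec := hdec) hB
    ((L : ℕ) : ZMod G.length) (hfin _) D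
    (fun I hI => hrange I (by simp [hI]))
    (by
      rw [hd]
      exact hAd.right)
    (by
      intro w hw I hI
      rw [hd]
      rcases circle_adj_cls hw with h | h
      · have h2 := cyclic_eq hG (A := z :: X2) (a := e) (C := d :: X'.reverse ++ G)
          (by simp [hGdef, hXe]) 0
        have h3 : 0 * G.length + (z :: X2).length = X.length := by
          rw [hXe]; simp
        rw [h3] at h2
        have h4 : B.cls w = e := h.trans h2
        rw [h4]
        exact (isTrail_junction.1 hAd).2.2 e (by simp [hXe, List.getLast?_cons]) I hI
      · have h2 := cyclic_eq hG (A := z :: (X ++ [d])) (a := e') (C := X2'.reverse ++ G)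
          (by simp [hGdef, hXe']) 0
        have h3 : 0 * G.length + (z :: (X ++ [d])).length = X.length + 2 := by simp
        rw [h3] at h2
        have h4 : B.cls w = e' := h.trans h2
        rw [h4]
        exact (isTrail_junction.1 hAd').2.2 e' (by simp [hXe', List.getLast?_cons]) I hI)
  have harc1 : B.Walk ((G.length : ℕ) : ZMod G.length) ((L : ℕ) : ZMod G.length)
      (arc G.length G.length L) := by
    have h1 := arc_walk (hper := hper) (hlink := fun n => (hcyc n).1)
      (hturn := fun n => (hcyc n).2) (by omega) L G.length
    have h2 : ((G.length + L : ℕ) : ZMod G.length) = ((L : ℕ) : ZMod G.length) := by simp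
    rwa [h2] at h1
  have harc2 : B.Walk ((G.length : ℕ) : ZMod G.length) ((L : ℕ) : ZMod G.length)
      (arc G.length L L).reverse := by
    have h1 := arc_walk (hper := hper) (hlink := fun n => (hcyc n).1)
      (hturn := fun n => (hcyc n).2) (by omega) L L
    have h2 : ((L + L : ℕ) : ZMod G.length) = ((G.length : ℕ) : ZMod G.length) := by
      congr 1; omega
    rw [h2] at h1
    exact h1.reverse
  have hcls1 : (arc G.length G.length L).map B.cls = z :: (X ++ [d]) := by
    have h1 := map_cls_arc (hper := hper) (hlink := fun n => (hcyc n).1)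
      (hturn := fun n => (hcyc n).2) L G.length
    have h2 := map_cyclic hG (A := []) (H := z :: (X ++ [d])) (C := X'.reverse ++ G)
      (by simp [hGdef]) 1
    have h3 : (z :: (X ++ [d])).length = L + 1 := by simp [hL]
    rw [h3] at h2
    simp only [one_mul, List.length_nil, add_zero] at h2
    exact h1.trans h2
  have hcls2 : (arc G.length L L).map B.cls = d :: (X'.reverse ++ [z]) := by
    have h1 := map_cls_arc (hper := hper) (hlink := fun n => (hcyc n).1)
      (hturn := fun n => (hcyc n).2) L L
    have h2 := map_cyclic hG (A := z :: X) (H := d :: (X'.reverse ++ [z]))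
      (C := X ++ d :: X'.reverse) (by simp [hGdef]) 0
    have h3 : (d :: (X'.reverse ++ [z])).length = L + 1 := by simp [hL]; omega
    have h4 : (z :: X).length = L := rfl
    rw [h3, h4] at h2
    simp only [zero_mul, zero_add] at h2
    exact h1.trans h2
  have hlk : kZ.length = Z.length ∧ kD.length = D.length := by
    constructor
    · have := congrArg List.length hkZ; simpa using this
    · have := congrArg List.length hkD; simpa using this
  have hw1 := harc1.with_tails (hdec := hdec) (by rw [length_arc]; omega) hwZ hwD hbZ hbD
  have hw2 := harc2.with_tails (hdec := hdec) (by rw [List.length_reverse, length_arc]; omega)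
    hwZ hwD hbZ hbD
  have ht1 := hUL.mem_terminalSet hfull hclosed hw1 (by
    simp only [List.length_append, List.length_reverse, List.length_map]
    rw [length_arc, hlk.1, hlk.2, hhtZ, hhtD, List.length_reverse]
    omega)
  have ht2 := hUL.mem_terminalSet hfull hclosed hw2 (by
    simp only [List.length_append, List.length_reverse, List.length_map]
    rw [length_arc, hlk.1, hlk.2, hhtZ, hhtD, List.length_reverse]
    omega)
  simp only [List.map_append, List.map_reverse, map_cls_map_base, hkZ, hkD] at ht1 ht2
  rw [hcls1] at ht1
  rw [hcls2] at ht2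
  refine ⟨toSkeleton hfull hclosed, toInstance hfull hclosed b, toInstance hfull hclosed y, ?_, ?_⟩
  · simpa using ht1
  · simpa using ht2

open RelationalSchema PartialSkeleton

/-! ### Chains of dependencies -/

namespace RelationalModel

variable {S : RelationalSchema.{u}} (M : RelationalModel S)

/-- Successive dependencies `Y → ... → X` of the model, the one with effect `X` first. -/
def DepChain : List (Dependency S) → S.Attr → S.Attr → Prop
  | [], X, Y => X = Y
  | d :: ds, X, Y => d ∈ M.deps ∧ d.effect = X ∧ DepChain ds d.cause Y

variable {M}

theorem DepChain.append {ds es : List (Dependency S)} {X Y Z : S.Attr} (h : M.DepChain ds X Y)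
    (h' : M.DepChain es Y Z) : M.DepChain (ds ++ es) X Z := by
  induction ds generalizing X with
  | nil => cases h; exact h'
  | cons d ds ih => exact ⟨h.1, h.2.1, ih h.2.2⟩

theorem exists_depChain {X Y : S.Attr} (h : Relation.TransGen M.ClassDep Y X) :
    ∃ d ds, M.DepChain (d :: ds) X Y := by
  induction h with
  | single h =>
    obtain ⟨d, hd, rfl, rfl⟩ := h
    exact ⟨d, [], hd, rfl, rfl⟩
  | tail _ h ih =>
    obtain ⟨d, hd, rfl, rfl⟩ := h
    obtain ⟨e, es, he⟩ := ih
    exact ⟨d, e :: es, hd, rfl, he⟩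

end RelationalModel

open RelationalModel

/-! ### Extending paths and walks along chains of dependencies -/

section Chains

variable {S : RelationalSchema.{u}} {M : RelationalModel S}

/-- `P'` arises from `P` by successive extensions by the cause paths of the dependencies. -/
def ExtendChain : List (Dependency S) → List S.Item → List S.Item → Prop
  | [], P, P' => P = P'
  | d :: ds, P, P' => ∃ P1 ∈ S.extend P d.causePath, ExtendChain ds P1 P'

theorem extend_ends {P Q W : List S.Item} (h : W ∈ S.extend P Q) :
    S.IsPath W ∧ W.head? = P.head? ∧ W.getLast? = Q.getLast? := by
  have hW : S.IsPath W := by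
    obtain ⟨i, -, -, h⟩ := h
    exact h
  obtain ⟨A, z, C, D, rfl, rfl, rfl, -⟩ := exists_of_mem_extend h
  refine ⟨hW, ?_, ?_⟩
  · cases A <;> simp
  · simp [List.getLast?_append, List.getLast?_cons]

/-- At the largest pivot the classes on the two sides differ, so the concatenation is always valid
and the chain never gets stuck. -/
theorem exists_extendChain (ds : List (Dependency S)) {X Y : S.Attr} {P : List S.Item}
    (hP : S.IsPath P) (hl : P.getLast? = some (S.owner X)) (h : M.DepChain ds X Y) :
    ∃ P', ExtendChain ds P P' ∧ S.IsPath P' ∧ P'.head? = P.head? ∧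
      P'.getLast? = some (S.owner Y) := by
  induction ds generalizing X P with
  | nil => cases h; exact ⟨P, rfl, hP, rfl, hl⟩
  | cons d ds ih =>
    obtain ⟨-, rfl, h3⟩ := h
    obtain ⟨A, z, C, D, hA, hC, hW⟩ := exists_reduced_concat (fun _ _ _ => turn_of_ne)
      (isPath_iff.1 hP).2 (isPath_iff.1 d.isPath).2 hl d.head_eq
    have hex : A ++ z :: D ∈ S.extend P d.causePath := by
      rw [hA, hC]
      exact mem_extend_of hW
    obtain ⟨h4, h5, h6⟩ := extend_ends hex
    obtain ⟨P', h7, h8, h9, h10⟩ := ih h4 (h6.trans d.last_eq) h3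
    exact ⟨P', ⟨_, hex, h7⟩, h8, h9.trans h5, h10⟩

/-- `y` is reached from `x` by successive walks along the cause paths of the dependencies. -/
def WalkChain (G : PartialSkeleton S) : List (Dependency S) → G.Node → G.Node → Prop
  | [], x, y => x = y
  | d :: ds, x, y => ∃ z q, G.Walk x z q ∧ q.map G.cls = d.causePath ∧ WalkChain G ds z y

/-- The extensions are undone from the last to the first, each by `IsFull.exists_split`. -/
theorem exists_walkChain {G : PartialSkeleton S} {J : Set S.Item} (hG : G.IsFull J)
    (ds : List (Dependency S)) (hJ : ∀ d ∈ ds, ∀ I ∈ d.causePath, I ∈ J) {P P' : List S.Item}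
    (hP : S.IsPath P) (h : ExtendChain ds P P') {x y : G.Node} {w : List G.Node}
    (hw : G.Walk x y w) (hwP : w.map G.cls = P') :
    ∃ z p, G.Walk x z p ∧ p.map G.cls = P ∧ WalkChain G ds z y := by
  induction ds generalizing P with
  | nil =>
    cases h
    exact ⟨y, w, hw, hwP, rfl⟩
  | cons d ds ih =>
    obtain ⟨P1, h1, h2⟩ := h
    obtain ⟨z, p, hp, hpP, hz⟩ := ih (fun e he => hJ e (List.mem_cons_of_mem _ he))
      (extend_ends h1).1 h2
    rw [← hpP] at h1
    obtain ⟨z', p', q, hp', hpP', hq, hqQ⟩ := hG.exists_split (isPath_iff.1 hP).2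
      (isPath_iff.1 d.isPath).2 (hJ d (by simp)) hp h1
    exact ⟨z', p', hp', hpP', z, q, hq, hqQ, hz⟩

theorem walkChain_of_extendChain {G : PartialSkeleton S} {J : Set S.Item} (hG : G.IsFull J)
    (ds : List (Dependency S)) (hJ : ∀ d ∈ ds, ∀ I ∈ d.causePath, I ∈ J) {I : S.Item}
    {P' : List S.Item} (h : ExtendChain ds [I] P') {x y : G.Node} {w : List G.Node}
    (hw : G.Walk x y w) (hwP : w.map G.cls = P') : WalkChain G ds x y := by
  obtain ⟨z, p, hp, hpP, hz⟩ := exists_walkChain hG ds hJ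
    (isPath_iff.2 ⟨by simp, isTrail_singleton I⟩) h hw hwP
  obtain ⟨_, rfl, -⟩ := List.map_eq_singleton_iff.1 hpP
  have h1 := hp.head
  have h2 := hp.last
  simp at h1 h2
  rw [← h1, h2]
  exact hz

/-- Concatenate and cancel turnings back. Unlike the splitting direction, this does not need a full
partial skeleton. -/
theorem exists_extendChain_of_walkChain {G : PartialSkeleton S} (ds : List (Dependency S))
    {b x y : G.Node} {p : List G.Node} (hp : G.Walk b x p) (h : WalkChain G ds x y) :
    ∃ w, G.Walk b y w ∧ ExtendChain ds (p.map G.cls) (w.map G.cls) := by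
  induction ds generalizing x p with
  | nil =>
    cases h
    exact ⟨p, hp, rfl⟩
  | cons d ds ih =>
    obtain ⟨z, q, hq, hqQ, hz⟩ := h
    obtain ⟨w, hw, hwex⟩ := hp.exists_extend hq
    obtain ⟨w', hw', hch⟩ := ih hw hz
    rw [hqQ] at hwex
    exact ⟨w', hw', _, hwex, hch⟩

end Chains

/-! ### Cycles in ground graphs -/

theorem not_isAncestral_of_cycle {V : Type*} {r : V → V → Prop} {v : V}
    (h : Relation.TransGen r v v) : ¬ (MixedGraph.ofDirected r).IsAncestral := by
  intro ha
  obtain ⟨w, hvw, hwv⟩ := Relation.TransGen.head'_iff.1 h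
  exact ha.1 w v hvw hwv

theorem isAncestral_of_acyclic {V : Type*} {r : V → V → Prop}
    (h : ∀ v, ¬ Relation.TransGen r v v) : (MixedGraph.ofDirected r).IsAncestral :=
  ⟨fun _ b hab hba => h b (Relation.TransGen.head' hab hba), fun _ _ h => h.elim,
    fun _ _ h => h.elim⟩

section GroundGraph

variable {S : RelationalSchema.{u}} {M : RelationalModel S} {G : PartialSkeleton S}
  {J : Set S.Item} (hG : G.IsFull J)
  (hJ : ∀ R, Sum.inr R ∈ J → ∀ E ∈ S.parts R, Sum.inl E ∈ J)

/-- The attribute `X` of a node, as a vertex of the ground graph. -/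
def attrVertex (x : G.Node) (X : S.Attr) (h : S.owner X = G.cls x) :
    GGVertex (toSkeleton hG hJ) := ⟨(toInstance hG hJ x, X), h⟩

theorem groundGraph_transGen_of_walkChain (ds : List (Dependency S)) :
    ∀ (d : Dependency S) {X Y : S.Attr} {x y : G.Node},
    (∀ e ∈ d :: ds, ∀ x z q, G.Walk x z q → q.map G.cls = e.causePath →
      toInstance hG hJ z ∈ (toSkeleton hG hJ).terminalSet (toInstance hG hJ x) e.causePath) →
    M.DepChain (d :: ds) X Y → WalkChain G (d :: ds) x y → ∀ hX : S.owner X = G.cls x,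
    ∃ hY : S.owner Y = G.cls y, Relation.TransGen (M.groundGraph (toSkeleton hG hJ)).dir
      (attrVertex hG hJ y Y hY) (attrVertex hG hJ x X hX) := by
  induction ds with
  | nil =>
    rintro d X Y x y hterm ⟨h1, rfl, h3⟩ ⟨z, q, hq, hqQ, hz⟩ hX
    cases h3
    cases hz
    have hY : S.owner d.cause = G.cls y := by
      have := d.last_eq
      rw [← hqQ, List.getLast?_map, hq.last] at this
      simpa using this.symm
    exact ⟨hY, .single ⟨d, h1, rfl, rfl, hterm d (by simp) x y q hq hqQ⟩⟩
  | cons e ds ih =>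
    rintro d X Y x y hterm ⟨h1, rfl, h3⟩ ⟨z, q, hq, hqQ, hz⟩ hX
    have hZ : S.owner d.cause = G.cls z := by
      have := d.last_eq
      rw [← hqQ, List.getLast?_map, hq.last] at this
      simpa using this.symm
    obtain ⟨hY, h⟩ := ih e (fun e' he' => hterm e' (List.mem_cons_of_mem _ he')) h3 hz hZ
    exact ⟨hY, h.tail ⟨d, h1, rfl, rfl, hterm d (by simp) x z q hq hqQ⟩⟩

end GroundGraph

section Main

variable {S : RelationalSchema.{u}} {M : RelationalModel S}

theorem UniqueLength.mem_terminalSet_of_dep {B : PartialSkeleton S} {Λ : Type} {dec : Λ → S.Item}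
    {hdec : Function.Injective dec} {L : ℕ} (hL : B.UniqueLength L)
    {J : Set S.Item} (hG : (B.hull hdec).IsFull J)
    (hJ : ∀ R, Sum.inr R ∈ J → ∀ E ∈ S.parts R, Sum.inl E ∈ J) {ds : List (Dependency S)}
    (hds : ∀ d ∈ ds, d.causePath.length ≤ L) :
    ∀ e ∈ ds, ∀ x z q, (B.hull hdec).Walk x z q → q.map (B.hull hdec).cls = e.causePath →
      toInstance hG hJ z ∈ (toSkeleton hG hJ).terminalSet (toInstance hG hJ x) e.causePath := by
  intro e he x z q hq hqQ
  rw [← hqQ]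
  apply hL.mem_terminalSet hG hJ hq
  have h1 := hds e he
  rw [← hqQ, List.length_map] at h1
  omega

/-- An enumeration of item classes containing those of the given dependencies. -/
theorem exists_enumeration_deps (ds : List (Dependency S)) :
    ∃ (n : ℕ) (dec : Fin n → S.Item), Function.Injective dec ∧
      (∀ d ∈ ds, ∀ I ∈ d.causePath, I ∈ Set.range dec) ∧
      ∀ R, Sum.inr R ∈ Set.range dec → ∀ E ∈ S.parts R, Sum.inl E ∈ Set.range dec := by
  obtain ⟨n, dec, h1, h2, h3⟩ := exists_enumeration (ds.flatMap Dependency.causePath)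
  exact ⟨n, dec, h1, fun d hd I hI => h2 I (List.mem_flatMap.2 ⟨d, hd, hI⟩), h3⟩

theorem extendChain_subset {ds : List (Dependency S)} {P P' : List S.Item}
    (h : ExtendChain ds P P') {I : S.Item} (hI : I ∈ P') :
    I ∈ P ∨ ∃ d ∈ ds, I ∈ d.causePath := by
  induction ds generalizing P with
  | nil => cases h; exact Or.inl hI
  | cons d ds ih =>
    obtain ⟨P1, h1, h2⟩ := h
    rcases ih h2 with h3 | ⟨e, he, h3⟩
    · obtain ⟨A, z, C, D, rfl, hQ, rfl, -⟩ := exists_of_mem_extend h1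
      simp only [List.mem_append, List.mem_cons] at h3 ⊢
      rcases h3 with h3 | h3 | h3
      · exact Or.inl (Or.inl h3)
      · exact Or.inl (Or.inr (Or.inl h3))
      · exact Or.inr ⟨d, by simp, by rw [hQ]; simp [h3]⟩
    · exact Or.inr ⟨e, by simp [he], h3⟩

/-- A closed chain of dependencies yields a cycle in a ground graph. -/
theorem exists_groundGraph_not_isAncestral {d : Dependency S} {ds : List (Dependency S)}
    {X : S.Attr} (h : M.DepChain (d :: ds) X X) :
    ∃ σ : Skeleton S, ¬ (M.groundGraph σ).IsAncestral := by
  obtain ⟨n, dec, hdec, hrange, hclosed⟩ := exists_enumeration_deps (d :: ds)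
  set I := S.owner X with hIdef
  have hId : I ∈ d.causePath := by
    have h1 := d.head_eq
    rw [h.2.1] at h1
    exact List.mem_of_mem_head? h1
  have hI : I ∈ Set.range dec := hrange d (by simp) I hId
  obtain ⟨P, hex, hP, hPh, hPl⟩ := exists_extendChain (d :: ds) (P := [I])
    (isPath_iff.2 ⟨by simp, isTrail_singleton I⟩) rfl h
  simp only [List.head?_cons] at hPh
  have hPt := (isPath_iff.1 hP).2
  have hPr : ∀ K ∈ P, K ∈ Set.range dec := by
    intro K hK
    rcases extendChain_subset hex hK with h1 | ⟨e, he, h1⟩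
    · simp at h1; exact h1 ▸ hI
    · exact hrange e he K h1
  obtain ⟨L, hL⟩ : ∃ L, ∀ e ∈ d :: ds, e.causePath.length ≤ L := by
    refine ⟨((d :: ds).map fun e => e.causePath.length).sum, fun e he => ?_⟩
    exact List.le_sum_of_mem (List.mem_map.2 ⟨e, he, rfl⟩)
  rcases reverse_eq_or_exists_ends P with hpal | ⟨T, a, l, b, hab, hPT⟩
  · let B := point I
    have hfull := isFull_hull (B := B) hdec (fun _ => hI)
    obtain ⟨Q, rfl⟩ : ∃ Q, P = I :: Q := by
      cases P with
      | nil => simp at hPh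
      | cons K Q => simp at hPh; exact ⟨Q, by rw [hPh]⟩
    obtain ⟨k, hk, hw, -⟩ := hfull.exists_walk Q (base hdec ()) ∅ Set.finite_empty
      (fun K hK => hPr K (by simp [hK])) hPt (by simp)
    obtain ⟨y, hy⟩ : ∃ y, (base hdec () :: k).getLast? = some y :=
      ⟨_, List.getLast?_eq_getLast_of_ne_nil (by simp)⟩
    have hwalk : (B.hull hdec).Walk (base hdec ()) y (base hdec () :: k) := ⟨hw, rfl, hy⟩
    have hcls : (base hdec () :: k).map (B.hull hdec).cls = I :: Q := by
      rw [List.map_cons, hk]; rfl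
    -- The reversed walk runs along `P` too, so the chain leads from the base node to `y` and back
    -- again.
    have hc1 := walkChain_of_extendChain hfull (d :: ds) hrange hex hwalk hcls
    have hc2 := walkChain_of_extendChain hfull (d :: ds) hrange hex hwalk.reverse (by
      rw [List.map_reverse, hcls, hpal])
    have hterm := UniqueLength.mem_terminalSet_of_dep (uniqueLength_point I L) hfull hclosed hL
    obtain ⟨hY, h1⟩ := groundGraph_transGen_of_walkChain hfull hclosed ds d hterm h hc1 rfl
    obtain ⟨hZ, h2⟩ := groundGraph_transGen_of_walkChain hfull hclosed ds d hterm h hc2 hY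
    exact ⟨_, not_isAncestral_of_cycle (h2.trans h1)⟩
  -- Both ends of `P` have class `I`, so they match and the tail is nonempty.
  · have hT : T ≠ [] := by
      rintro rfl
      have h1 : a = I := by simpa [hPT] using hPh
      have h2 : b = I := by simpa [hPT, List.getLast?_append, List.getLast?_cons] using hPl
      exact hab (h1.trans h2.symm)
    obtain ⟨T, z, rfl⟩ := (List.eq_nil_or_concat T).resolve_left hT
    simp only [List.concat_eq_append, List.reverse_append, List.reverse_cons, List.reverse_nil,
      List.nil_append, List.append_assoc, List.cons_append] at hPT
    set G : List S.Item := z :: a :: (l ++ [b]) with hGdef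
    have hG : 0 < G.length := by simp [hGdef]
    have hG3 : 3 ≤ G.length := by simp [hGdef]
    have hPG : P = T ++ (G ++ z :: T.reverse) := by rw [hPT]; simp [hGdef]
    have hround : IsTrail S.Linked S.Turn (G ++ [z]) := by
      rw [hPG] at hPt
      exact hPt.suffix.left
    have hGG : IsTrail S.Linked S.Turn (G ++ G) := by
      refine isTrail_junction.2 ⟨hround, hround.prefix, ?_⟩
      intro u hu v hv
      have hu' : b = u := by simpa [hGdef, List.getLast?_cons] using hu
      have hv' : a = v := by simpa using hv
      subst hu' hv'
      exact turn_of_ne hab.symm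
    -- So many turns make the circle longer than `2 * L`, where `L` bounds the cause paths; the `+
    -- 1` keeps it nonempty.
    set N := 2 * L + 1 with hN
    have hNM : N ≤ N * G.length := Nat.le_mul_of_pos_right N hG
    have hGM : G.length ≤ N * G.length := Nat.le_mul_of_pos_left _ (by omega)
    have : NeZero (N * G.length) := ⟨by omega⟩
    have hcyc := cyclic_trail hG hGG (by omega)
    have hper := cyclic_periodic hG N
    let B := circle (cyclic hG) (N * G.length) hper (fun n => (hcyc n).1) (fun n => (hcyc n).2)
    have hfin : ∀ v : B.Node, {w | B.adj v w}.Finite := fun v =>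
      Set.toFinite (α := ZMod (N * G.length)) _
    have hB : ∀ v, B.cls v ∈ Set.range dec := by
      intro v
      have h1 : B.cls v ∈ G := List.getElem_mem _
      apply hPr
      rw [hPG]
      simp only [List.mem_append]
      exact Or.inr (Or.inl h1)
    have hfull := isFull_hull hdec hB
    have hz : ∀ j : ℕ, B.cls ((j * G.length : ℕ) : ZMod (N * G.length)) = z := by
      intro j
      have h2 := cyclic_eq hG (A := []) (a := z) (C := a :: (l ++ [b]) ++ G) (by simp [hGdef]) j
      exact (circle_cls_natCast _).trans h2
    have htail : ∀ v : B.Node, (∃ j : ℕ, v = ((j * G.length : ℕ) : ZMod (N * G.length))) →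
        ∃ (k : List (B.hull hdec).Node) (y : (B.hull hdec).Node),
          k.map (B.hull hdec).cls = T.reverse ∧
          (B.hull hdec).Walk (base hdec v) y (base hdec v :: k) ∧
          ∀ b ∈ k.head?, ∀ w, b ≠ base hdec w := by
      rintro v ⟨j, rfl⟩
      obtain ⟨k, y, h1, h2, -, h3⟩ := exists_tail (hdec := hdec) hB
        ((j * G.length : ℕ) : ZMod (N * G.length)) (hfin _) T.reverse
        (fun I hI => hPr I (by rw [hPG]; simp at hI; simp [hI]))
        (by
          rw [hz]
          rw [hPG, ← List.append_assoc] at hPt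
          exact hPt.right)
        (by
          intro w hw K hK
          rw [hz]
          -- Adding one full circle writes the node as a successor, even for `j = 0`.
          have hj : ((j * G.length : ℕ) : ZMod (N * G.length)) =
              (((j + N) * G.length - 1 + 1 : ℕ) : ZMod (N * G.length)) := by
            have h1 : (j + N) * G.length - 1 + 1 = j * G.length + N * G.length := by
              rw [add_mul]; omega
            rw [h1, Nat.cast_add (j * G.length) (N * G.length), ZMod.natCast_self, add_zero]
          rw [hj] at hw
          have hpos : G.length ≤ (j + N) * G.length := by rw [add_mul]; omega
          rcases circle_adj_cls hw with h | h
          · have h2 := cyclic_eq hG (A := z :: a :: l) (a := b) (C := G)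
              (by simp [hGdef]) (j + N - 1)
            have h3 : (j + N - 1) * G.length + (z :: a :: l).length =
                (j + N) * G.length - 1 := by
              have h4 : (j + N) * G.length = (j + N - 1) * G.length + G.length := by
                rw [← Nat.succ_mul]
                congr 1
              have h5 : G.length = (z :: a :: l).length + 1 := by simp [hGdef]
              omega
            rw [h3] at h2
            have h4 : B.cls w = b := h.trans h2
            rw [h4]
            have h5 : P = (T ++ z :: a :: (l ++ [b])) ++ z :: T.reverse := by
              rw [hPT]; simp
            rw [h5] at hPt
            exact (isTrail_junction.1 hPt).2.2 b
              (by simp [List.getLast?_append, List.getLast?_cons]) K hK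
          · have h2 := cyclic_eq hG (A := [z]) (a := a) (C := l ++ [b] ++ G)
              (by simp [hGdef]) (j + N)
            have h3 : (j + N) * G.length + [z].length = (j + N) * G.length - 1 + 2 := by
              simp
              omega
            rw [h3] at h2
            have h4 : B.cls w = a := h.trans h2
            rw [h4]
            rw [hPT] at hPt
            rw [List.head?_reverse] at hK
            exact ((isTrail_junction.1 hPt).2.2 K hK a rfl).symm)
      exact ⟨k, y, h1, h2, h3⟩
    have : Nonempty (B.hull hdec).Node := ⟨base hdec (0 : ZMod (N * G.length))⟩
    choose! k y hk hkw hkb using htail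
    let v : ℕ → B.Node := fun j => ((j * G.length : ℕ) : ZMod (N * G.length))
    -- Down one tail, once through the loop, up the next tail: this is a walk along `P`.
    have hstep : ∀ j, WalkChain (B.hull hdec) (d :: ds) (y (v j)) (y (v (j + 1))) := by
      intro j
      have harc : B.Walk (v j) (v (j + 1)) (arc (N * G.length) (j * G.length) G.length) := by
        have h1 := arc_walk (hper := hper) (hlink := fun n => (hcyc n).1)
          (hturn := fun n => (hcyc n).2) (by omega) G.length (j * G.length)
        rw [← Nat.succ_mul] at h1
        exact h1
      have hcls : (arc (N * G.length) (j * G.length) G.length).map B.cls = G ++ [z] := by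
        have h1 := map_cls_arc (hper := hper) (hlink := fun n => (hcyc n).1)
          (hturn := fun n => (hcyc n).2) G.length (j * G.length)
        have h2 := map_cyclic hG (A := []) (H := G ++ [z]) (C := a :: (l ++ [b]))
          (by simp [hGdef]) j
        have h3 : (G ++ [z]).length = G.length + 1 := by simp
        rw [h3] at h2
        simp only [List.length_nil, add_zero] at h2
        exact h1.trans h2
      have hw := harc.with_tails (hdec := hdec) (by rw [length_arc]; omega) (hkw _ ⟨j, rfl⟩)
        (hkw _ ⟨j + 1, rfl⟩) (hkb _ ⟨j, rfl⟩) (hkb _ ⟨j + 1, rfl⟩)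
      refine walkChain_of_extendChain hfull (d :: ds) hrange hex hw ?_
      rw [List.map_append, List.map_append, List.map_reverse, map_cls_map_base, hcls,
        hk _ ⟨j, rfl⟩, hk _ ⟨j + 1, rfl⟩, hPG]
      simp
    have hUL : B.UniqueLength L := uniqueLength_circle (by omega)
    have hterm := UniqueLength.mem_terminalSet_of_dep hUL hfull hclosed hL
    have hX0 : S.owner X = (B.hull hdec).cls (y (v 0)) := by
      have h1 := (hkw _ ⟨0, rfl⟩ : (B.hull hdec).Walk (base hdec (v 0)) (y (v 0)) _).last
      have h2 : (z :: T.reverse).getLast? = some I := by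
        rw [← hPl, hPG, ← List.append_assoc, List.getLast?_append]
        simp [List.getLast?_cons]
      have h3 : (base hdec (v 0) :: k (v 0)).map (B.hull hdec).cls = z :: T.reverse := by
        rw [List.map_cons, hk _ ⟨0, rfl⟩]
        congr 1
        exact hz 0
      rw [← h3, List.getLast?_map, h1] at h2
      simpa using h2.symm
    have hall : ∀ j, ∃ hX : S.owner X = (B.hull hdec).cls (y (v (j + 1))),
        Relation.TransGen (M.groundGraph (toSkeleton hfull hclosed)).dir
          (attrVertex hfull hclosed (y (v (j + 1))) X hX)
          (attrVertex hfull hclosed (y (v 0)) X hX0) := by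
      intro j
      induction j with
      | zero =>
        exact groundGraph_transGen_of_walkChain hfull hclosed ds d hterm h (hstep 0) hX0
      | succ j ih =>
        obtain ⟨hX, h1⟩ := ih
        obtain ⟨hY, h2⟩ :=
          groundGraph_transGen_of_walkChain hfull hclosed ds d hterm h (hstep (j + 1)) hX
        exact ⟨hY, h2.trans h1⟩
    -- After `N` turns the circle closes.
    have hv : v (2 * L + 1) = v 0 := by
      change ((N * G.length : ℕ) : ZMod (N * G.length)) =
        ((0 * G.length : ℕ) : ZMod (N * G.length))
      simp
    obtain ⟨hX, hcycle⟩ := hall (2 * L)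
    have : attrVertex hfull hclosed (y (v (2 * L + 1))) X hX =
        attrVertex hfull hclosed (y (v 0)) X hX0 := by
      simp only [hv]
    rw [this] at hcycle
    exact ⟨_, not_isAncestral_of_cycle hcycle⟩

/-! ### Cycles in abstract ground graphs -/

/-- A relational variable without bound on the number of hops. -/
def relVarOf {B : S.Item} (P : List S.Item) (X : S.Attr) (hP : S.IsPath P)
    (hh : P.head? = some B) (hl : P.getLast? = some (S.owner X)) : RelVar S B ⊤ where
  path := P
  attr := X
  isPath := hP
  head_eq := hh
  last_eq := hl
  length_le := by simp

/-- The start `v` is any vertex with the outgoing edges of the last variable: that variable itself,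
or an intersection variable containing it. -/
theorem agg_transGen_of_extendChain {B : S.Item} (ds : List (Dependency S)) :
    ∀ (d : Dependency S) {X Y : S.Attr} {P P' : List S.Item} (hP : S.IsPath P)
    (hh : P.head? = some B) (hl : P.getLast? = some (S.owner X)) (hP' : S.IsPath P')
    (hh' : P'.head? = some B) (hl' : P'.getLast? = some (S.owner Y)) (v : AGGVertex S B ⊤),
    (∀ U, M.VarEdge (relVarOf P' Y hP' hh' hl') U → M.AGGEdge v (.var U)) →
    M.DepChain (d :: ds) X Y → ExtendChain (d :: ds) P P' →
    Relation.TransGen M.AGGEdge v (.var (relVarOf P X hP hh hl)) := by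
  induction ds with
  | nil =>
    rintro d X Y P P' hP hh hl hP' hh' hl' v hv ⟨h1, h2, h3⟩ ⟨P1, h4, h5⟩
    cases h3
    cases h5
    exact .single (hv _ ⟨d, h1, rfl, h2, h4⟩)
  | cons e ds ih =>
    rintro d X Y P P' hP hh hl hP' hh' hl' v hv ⟨h1, h2, h3⟩ ⟨P1, h4, h5⟩
    obtain ⟨h6, h7, h8⟩ := extend_ends h4
    have := ih e h6 (h7.trans hh) (h8.trans d.last_eq) hP' hh' hl' v hv h3 h5
    exact this.tail (⟨d, h1, rfl, h2, h4⟩ : M.VarEdge (relVarOf P1 d.cause h6 _ _) _)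

/-- At least two dependencies are needed: intersection variables have no edges among themselves, so
the cycle through one must pass a relational variable. -/
theorem not_isAncestral_of_extendChain {B : S.Item} {d e : Dependency S} {ds : List (Dependency S)}
    {X : S.Attr} {P P' : List S.Item} (hP : S.IsPath P) (hh : P.head? = some B)
    (hl : P.getLast? = some (S.owner X)) (hP' : S.IsPath P') (hh' : P'.head? = some B)
    (hl' : P'.getLast? = some (S.owner X)) (hlen : P.length = P'.length)
    (h : M.DepChain (d :: e :: ds) X X) (hex : ExtendChain (d :: e :: ds) P P') :
    ¬ (M.abstractGroundGraph B ⊤).IsAncestral := by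
  by_cases heq : P = P'
  · subst heq
    exact not_isAncestral_of_cycle (agg_transGen_of_extendChain (e :: ds) d hP hh hl hP' hh' hl'
      (.var (relVarOf P X hP hh hl)) (fun U hU => hU) h hex)
  · have hint : (relVarOf P X hP hh hl).CanIntersect (relVarOf P' X hP' hh' hl') :=
      ⟨fun h => heq (congrArg RelVar.path h), rfl,
        exists_common_terminal hP hP' heq hlen (hh.trans hh'.symm) (hl.trans hl'.symm)⟩
    let v : AGGVertex S B ⊤ := .inter s(_, _) ⟨_, _, hint, rfl⟩
    obtain ⟨h1, h2, h3⟩ := h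
    obtain ⟨P1, h4, h5⟩ := hex
    obtain ⟨h6, h7, h8⟩ := extend_ends h4
    have h9 := agg_transGen_of_extendChain ds e h6 (h7.trans hh) (h8.trans d.last_eq) hP' hh' hl' v
      (fun U hU => ⟨_, Sym2.mem_mk_right _ _, hU⟩) h3 h5
    have h10 : M.AGGEdge (.var (relVarOf P1 d.cause h6 (h7.trans hh) (h8.trans d.last_eq))) v :=
      ⟨_, Sym2.mem_mk_left _ _, d, h1, rfl, h2, h4⟩
    exact not_isAncestral_of_cycle (h9.tail h10)

/-- A closed chain of at least two dependencies yields a cycle in an abstract ground graph. -/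
theorem exists_abstractGroundGraph_not_isAncestral {d e : Dependency S}
    {ds : List (Dependency S)} {X : S.Attr} (h : M.DepChain (d :: e :: ds) X X) :
    ∃ B : S.Item, ¬ (M.abstractGroundGraph B ⊤).IsAncestral := by
  obtain ⟨n, dec, hdec, hrange, hclosed⟩ := exists_enumeration_deps (d :: e :: ds)
  set I := S.owner X with hIdef
  have hId : I ∈ d.causePath := by
    have h1 := d.head_eq
    rw [h.2.1] at h1
    exact List.mem_of_mem_head? h1
  have hI : I ∈ Set.range dec := hrange d (by simp) I hId
  obtain ⟨P, hex, hP, hPh, hPl⟩ := exists_extendChain (d :: e :: ds) (P := [I])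
    (isPath_iff.2 ⟨by simp, isTrail_singleton I⟩) rfl h
  simp only [List.head?_cons] at hPh
  have hPt := (isPath_iff.1 hP).2
  have hPr : ∀ K ∈ P, K ∈ Set.range dec := by
    intro K hK
    rcases extendChain_subset hex hK with h1 | ⟨e, he, h1⟩
    · simp at h1; exact h1 ▸ hI
    · exact hrange e he K h1
  obtain ⟨Q, rfl⟩ : ∃ Q, P = I :: Q := by
    cases P with
    | nil => simp at hPh
    | cons K Q => simp at hPh; exact ⟨Q, by rw [hPh]⟩
  -- Entity and relationship classes alternate along `P`, and its ends agree, so there is a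
  -- midpoint.
  obtain ⟨m, hm⟩ : Even Q.length := (isLeft_eq_iff_even hPt hPl).1 rfl
  let T := (point I).hull hdec
  have hfull : T.IsFull (Set.range dec) := isFull_hull (B := point I) hdec (fun _ => hI)
  obtain ⟨x, hx⟩ : ∃ x : T.Node, T.cls x = I := ⟨base hdec (), rfl⟩
  obtain ⟨k, hk, hw, -⟩ := hfull.exists_walk Q x ∅ Set.finite_empty
    (fun K hK => hPr K (by simp [hK])) (by rw [hx]; exact hPt) (by simp)
  obtain ⟨y, hy⟩ : ∃ y, (x :: k).getLast? = some y :=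
    ⟨_, List.getLast?_eq_getLast_of_ne_nil (by simp)⟩
  have hcls : (x :: k).map T.cls = I :: Q := by rw [List.map_cons, hk, hx]
  have hyI : T.cls y = I := by
    rw [← hcls, List.getLast?_map, hy] at hPl
    simpa using hPl
  have hc : WalkChain T (d :: e :: ds) x y :=
    walkChain_of_extendChain hfull _ hrange hex ⟨hw, rfl, hy⟩ hcls
  have hkl : k.length = m + m := by rw [← hm, ← hk, List.length_map]
  obtain ⟨α, β, δ, hsplit, hα, hδ⟩ : ∃ α β δ, x :: k = α ++ β :: δ ∧ α.length = m ∧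
      δ.length = m := by
    refine ⟨(x :: k).take m, (x :: k)[m]'(by simp; omega), (x :: k).drop (m + 1), ?_, ?_, ?_⟩
    · rw [← List.drop_eq_getElem_cons, List.take_append_drop]
    · rw [List.length_take, List.length_cons]; omega
    · rw [List.length_drop, List.length_cons]; omega
  rw [hsplit] at hw hy
  have hw1 : T.Walk β x (β :: α.reverse) := by
    have h1 := isWalk_reverse hw.left
    rw [List.reverse_append] at h1
    refine ⟨h1, rfl, ?_⟩
    have h2 : (α ++ β :: δ).head? = some x := by rw [← hsplit]; rfl
    rw [List.getLast?_cons, List.getLast?_reverse]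
    cases α with
    | nil => simpa using h2
    | cons a α => simpa using h2
  have hw2 : T.Walk β y (β :: δ) := by
    refine ⟨hw.right, rfl, ?_⟩
    rw [List.getLast?_append] at hy
    simpa [List.getLast?_cons] using hy
  obtain ⟨w, hw3, hch⟩ := exists_extendChain_of_walkChain _ hw1 hc
  -- In a tree, the walk produced by the chain and the second half of the original walk join the
  -- same nodes, so they have equal length. The bound on lengths is arbitrary for a point.
  have hlen : w.length = (β :: δ).length :=
    (uniqueLength_point I (w.length + (β :: δ).length)).hull (hdec := hdec) _ β y w (β :: δ) rfl
      hw3 hw2 (by omega) (by omega)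
  refine ⟨T.cls β, not_isAncestral_of_extendChain hw1.isPath ?_ ?_ hw3.isPath ?_ ?_ ?_ h hch⟩
  · rw [List.head?_map, hw1.head]; rfl
  · rw [List.getLast?_map, hw1.last, Option.map_some, hx]
  · rw [List.head?_map, hw3.head]; rfl
  · rw [List.getLast?_map, hw3.last, Option.map_some, hyI]
  · rw [List.length_map, List.length_map, hlen]
    simp [hα, hδ]

/-! ### Acyclic models -/

theorem groundGraph_isAncestral (h : M.IsAcyclic) (σ : Skeleton S) :
    (M.groundGraph σ).IsAncestral := by
  refine isAncestral_of_acyclic fun v hv => h v.1.2 ?_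
  refine Relation.TransGen.lift (p := M.ClassDep) (fun v : GGVertex σ => v.1.2) ?_ _ _ hv
  rintro a b ⟨d, hd, h1, h2, -⟩
  exact ⟨d, hd, h1, h2⟩

/-- Both members of an intersection variable have the same attribute class, so every vertex has a
well-defined one and edges project to class dependencies. -/
theorem abstractGroundGraph_isAncestral (h : M.IsAcyclic) (B : S.Item) (n : ℕ∞) :
    (M.abstractGroundGraph B n).IsAncestral := by
  have hattr : ∀ v : AGGVertex S B n, ∃ X : S.Attr, match v with
      | .var U => U.attr = X
      | .inter p _ => ∀ U ∈ p, U.attr = X := by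
    rintro (U | ⟨p, U, V, hUV, rfl⟩)
    · exact ⟨_, rfl⟩
    · refine ⟨U.attr, fun W hW => ?_⟩
      rcases Sym2.mem_iff.1 hW with rfl | rfl
      · rfl
      · exact hUV.2.1.symm
  choose attr hattr using hattr
  have hdep : ∀ (V U : RelVar S B n), M.VarEdge V U → M.ClassDep V.attr U.attr :=
    fun V U ⟨d, hd, h1, h2, _⟩ => ⟨d, hd, h1, h2⟩
  refine isAncestral_of_acyclic fun v hv => h (attr v) ?_
  refine Relation.TransGen.lift (p := M.ClassDep) attr ?_ _ _ hv
  rintro (V | ⟨p, hp⟩) (U | ⟨q, hq⟩) hVU <;> change M.ClassDep (attr _) (attr _)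
  · rw [← hattr (.var V), ← hattr (.var U)]
    exact hdep _ _ hVU
  · obtain ⟨U, hU, hVU⟩ := hVU
    rw [← hattr (.var V), ← hattr (.inter q hq) U hU]
    exact hdep _ _ hVU
  · obtain ⟨V, hV, hVU⟩ := hVU
    rw [← hattr (.inter p hp) V hV, ← hattr (.var U)]
    exact hdep _ _ hVU
  · exact hVU.elim

end Main

/-! ### The equivalences -/

theorem lemma1 (S : RelationalSchema.{u}) (M : RelationalModel S) :
    (M.IsAcyclic → ∀ (B : S.Item) (h : ℕ∞),
      ((M.abstractGroundGraph B h).IsAncestral ↔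
        ∀ σ : Skeleton S, (M.groundGraph σ).IsAncestral)) ∧
    ((∀ (B : S.Item) (h : ℕ∞), (M.abstractGroundGraph B h).IsAncestral) ↔
      ∀ σ : Skeleton S, (M.groundGraph σ).IsAncestral) := by
  refine ⟨fun h B n => iff_of_true (abstractGroundGraph_isAncestral h B n)
    (groundGraph_isAncestral h), ?_⟩
  by_cases h : M.IsAcyclic
  · exact iff_of_true (abstractGroundGraph_isAncestral h) (groundGraph_isAncestral h)
  · obtain ⟨X, hX⟩ := not_forall_not.1 h
    obtain ⟨d, ds, hds⟩ := exists_depChain hX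
    refine iff_of_false (fun hA => ?_) fun hA => ?_
    -- Running through the closed chain twice gives at least two dependencies.
    · have h2 : ∃ e es, M.DepChain (d :: e :: es) X X := by
        have h3 := hds.append hds
        cases ds with
        | nil => exact ⟨d, [], h3⟩
        | cons e es => exact ⟨e, _, h3⟩
      obtain ⟨e, es, h2⟩ := h2
      obtain ⟨B, hB⟩ := exists_abstractGroundGraph_not_isAncestral h2
      exact hB (hA B ⊤)
    · obtain ⟨σ, hσ⟩ := exists_groundGraph_not_isAncestral hds
      exact hσ (hA σ)
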